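/- A triangle ${\sf T}$ in the plane is the closed convex hull of three points, its vertices; $\alpha({\sf T})$ denotes its smallest interior angle in radians, with $\alpha({\sf T})=0$ if ${\sf T}$ is degenerate. A triangle is *weakly inscribed* in an open set $\Omega\subset\mathbb R^2$ if its interior is contained in $\Omega$ and all its vertices lie on $\partial\Omega$. The interior of a Jordan curve is the bounded component of its complement. Let $0<\alpha\le\arcsin(\sqrt2/4)$, let $L=\frac12+\frac1{\sqrt2\tan\alpha}$, and let $\mathcal H$ be the hourglass-shaped hexagon with consecutive vertices $$\left(-L,-\tfrac1{\sqrt2}\right),\ \left(L,-\tfrac1{\sqrt2}\right),\ \left(\tfrac12,0\right),\ \left(L,\tfrac1{\sqrt2}\right),\ \left(-L,\tfrac1{\sqrt2}\right),\ \left(-\tfrac12,0\right),$$ so that the angle of $\mathcal H$ at each of its four outer vertices is $\alpha$. Then for every $\varepsilon>0$ there is an $\eta$ with $0<\eta<\varepsilon$ such that the set $\mathcal H_\varepsilon$ obtained from $\mathcal H$ by replacing each of its six sides with the circular arc of height $\eta$ that has this side as chord and lies on the inner side of it is a Jordan curve, and $$\alpha({\sf T})\le\arctan(\sqrt2)+\varepsilon$$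 for every triangle ${\sf T}$ weakly inscribed in the interior of $\mathcal H_\varepsilon$. -/

import Mathlib

/-- The Euclidean plane. -/
abbrev Plane : Type := EuclideanSpace ℝ (Fin 2)

/-- A Jordan curve: the trace of a simple closed curve in the plane. -/
def IsJordanCurve (γ : Set Plane) : Prop :=
  ∃ f : ℝ → Plane, ContinuousOn f (Set.Icc 0 1) ∧ f 0 = f 1 ∧
    Set.InjOn f (Set.Ico 0 1) ∧ f '' Set.Icc 0 1 = γ

/-- The interior of a Jordan curve `γ`: the bounded connected component of its complement, given as
the set of the points off `γ` whose connected component in the complement of `γ` is bounded. -/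
def jordanInterior (γ : Set Plane) : Set Plane :=
  {x | x ∈ γᶜ ∧ Bornology.IsBounded (connectedComponentIn γᶜ x)}

/-- The (closed) triangle with vertices `P`, `Q`, `R`. -/
def triangle (P Q R : Plane) : Set Plane :=
  convexHull ℝ {P, Q, R}

/-- The triangle with vertices `P`, `Q`, `R` is weakly inscribed in `Ω`: its interior is contained
in `Ω` and its vertices lie on the boundary of `Ω`. -/
def IsWeaklyInscribed (P Q R : Plane) (Ω : Set Plane) : Prop :=
  interior (triangle P Q R) ⊆ Ω ∧ P ∈ frontier Ω ∧ Q ∈ frontier Ω ∧ R ∈ frontier Ω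

open Classical in
/-- The smallest interior angle of the triangle with vertices `P`, `Q`, `R`, in radians; it is `0`
for a degenerate triangle. -/
noncomputable def minAngle (P Q R : Plane) : ℝ :=
  if Collinear ℝ {P, Q, R} then 0
  else min (EuclideanGeometry.angle Q P R)
    (min (EuclideanGeometry.angle P Q R) (EuclideanGeometry.angle P R Q))

/-- The unit normal of the segment from `P` to `Q` that points to the left of the direction of
travel. -/
noncomputable def leftNormal (P Q : Plane) : Plane :=
  (dist P Q)⁻¹ • !₂[-(Q 1 - P 1), Q 0 - P 0]

/-- The radius of the circles in which a chord `PQ` cuts off a circular segment of height `η`. -/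
noncomputable def arcRadius (P Q : Plane) (η : ℝ) : ℝ :=
  ((dist P Q / 2) ^ 2 + η ^ 2) / (2 * η)

/-- The centre of the circle through `P` and `Q` that cuts off a circular segment of height `η` on
the left of the chord from `P` to `Q`. -/
noncomputable def arcCenter (P Q : Plane) (η : ℝ) : Plane :=
  midpoint ℝ P Q + (η - arcRadius P Q η) • leftNormal P Q

/-- The closed circular arc of height `η > 0` with chord `PQ`, on the left of the chord from `P` to
`Q`. -/
noncomputable def circularArc (P Q : Plane) (η : ℝ) : Set Plane :=
  {X | dist X (arcCenter P Q η) = arcRadius P Q η ∧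
    0 ≤ inner ℝ (X - midpoint ℝ P Q) (leftNormal P Q)}

/-- Half the length of the horizontal sides of the hourglass with acute angles `α`. -/
noncomputable def hourglassHalfWidth (α : ℝ) : ℝ :=
  1 / 2 + 1 / (Real.sqrt 2 * Real.tan α)

/-- The vertices of the hourglass-shaped hexagon with angle `α` at its four outer vertices, in
counterclockwise order (so that the interior is on the left of each side):
lower left, lower right, right waist, upper right, upper left, left waist. -/
noncomputable def hourglassVertex (α : ℝ) : Fin 6 → Plane :=
  ![!₂[-hourglassHalfWidth α, -(1 / Real.sqrt 2)],
    !₂[hourglassHalfWidth α, -(1 / Real.sqrt 2)],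
    !₂[1 / 2, 0],
    !₂[hourglassHalfWidth α, 1 / Real.sqrt 2],
    !₂[-hourglassHalfWidth α, 1 / Real.sqrt 2],
    !₂[-(1 / 2), 0]]

/-- The hourglass with each side replaced by the inward-facing circular arc of height `η` that has
this side as chord (indices in `Fin 6` are cyclic, `5 + 1 = 0`). -/
noncomputable def bumpedHourglass (α η : ℝ) : Set Plane :=
  ⋃ i : Fin 6, circularArc (hourglassVertex α i) (hourglassVertex α (i + 1)) η

/-! The sides bulge inwards, so a segment joining two points of one arc runs through the outside.
Two points on opposite slanted arcs of one notch cannot be joined either, since the segment would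
cross the horizontal axis beyond the waist. Call top, bottom, left notch and right notch the four
zones; a weakly inscribed triangle then has its vertices in three different zones. Put h = 1/√2,
half the height of the hourglass, which is also the cotangent of arctan √2. Let q < h be the
cotangent of the angle to be excluded, and suppose that all three cotangents are at most q.

With one vertex on top and one in each notch, the base has horizontal width at least 1 and the apex
height is essentially at most h. The base cotangents add up to base over height, so to at least 1/h
= 2h, and one of them is at least h (`not_top_right_left`). With vertices on top, at the bottom and
at the waist point, the side from top to bottom has length almost 2h and the height over it is at
most 1, so again two cotangents have sum greater than 2q. If the vertex in the notch is off the
axis, visibility through the waist forces an angle of at most 45° (`not_top_bot_right_of_nonneg`).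
Reflections give the other cases.

The Jordan curve theorem is not used. A point is recognised as exterior by an explicit ray to
infinity missing the curve (`Free`, `not_mem_closure_jordanInterior`). The choice of η only has to
make the arcs flat enough, that is, their centres far enough from the chords. -/

/-! ### Concatenation of simple arcs. -/

/-- `A` is the trace of a simple arc from `p` to `q`. -/
def IsSimpleArc (A : Set Plane) (p q : Plane) : Prop :=
  ∃ f : ℝ → Plane, ContinuousOn f (Set.Icc 0 1) ∧ Set.InjOn f (Set.Icc 0 1) ∧
    f 0 = p ∧ f 1 = q ∧ f '' Set.Icc 0 1 = A

/-- The concatenation of two paths, each parametrized by `[0, 1]`. -/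
noncomputable def concatPath (f g : ℝ → Plane) (t : ℝ) : Plane :=
  if t ≤ 1 / 2 then f (2 * t) else g (2 * t - 1)

lemma continuousOn_concatPath {f g : ℝ → Plane} (hf : ContinuousOn f (Set.Icc 0 1))
    (hg : ContinuousOn g (Set.Icc 0 1)) (h : f 1 = g 0) :
    ContinuousOn (concatPath f g) (Set.Icc 0 1) := by
  have h1 : ContinuousOn (concatPath f g) (Set.Icc 0 (1 / 2)) := by
    have : ContinuousOn (fun t : ℝ => f (2 * t)) (Set.Icc 0 (1 / 2)) :=
      hf.comp (by fun_prop) (fun t ht => ⟨by linarith [ht.1], by linarith [ht.2]⟩)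
    refine this.congr fun t ht => ?_
    simp only [concatPath, if_pos ht.2]
  have h2 : ContinuousOn (concatPath f g) (Set.Icc (1 / 2) 1) := by
    have : ContinuousOn (fun t : ℝ => g (2 * t - 1)) (Set.Icc (1 / 2) 1) :=
      hg.comp (by fun_prop) (fun t ht => ⟨by linarith [ht.1], by linarith [ht.2]⟩)
    refine this.congr fun t ht => ?_
    rcases eq_or_lt_of_le ht.1 with h' | h'
    · subst h'
      simp [concatPath, h]
    · simp only [concatPath, if_neg (not_le.2 h')]
  have h3 : Set.Icc (0 : ℝ) 1 = Set.Icc 0 (1 / 2) ∪ Set.Icc (1 / 2) 1 :=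
    (Set.Icc_union_Icc_eq_Icc (by norm_num) (by norm_num)).symm
  rw [h3]
  exact h1.union_of_isClosed h2 isClosed_Icc isClosed_Icc

lemma image_concatPath {f g : ℝ → Plane} (h : f 1 = g 0) :
    concatPath f g '' Set.Icc 0 1 = f '' Set.Icc 0 1 ∪ g '' Set.Icc 0 1 := by
  ext z
  constructor
  · rintro ⟨t, ht, rfl⟩
    by_cases h' : t ≤ 1 / 2
    · left
      exact ⟨2 * t, ⟨by linarith [ht.1], by linarith⟩, by simp only [concatPath, if_pos h']⟩
    · right
      exact ⟨2 * t - 1, ⟨by linarith, by linarith [ht.2]⟩, by simp only [concatPath, if_neg h']⟩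
  · rintro (⟨t, ht, rfl⟩ | ⟨t, ht, rfl⟩)
    · refine ⟨t / 2, ⟨by linarith [ht.1], by linarith [ht.2]⟩, ?_⟩
      have : t / 2 ≤ 1 / 2 := by linarith [ht.2]
      simp only [concatPath, if_pos this]
      congr 1
      ring
    · refine ⟨(t + 1) / 2, ⟨by linarith [ht.1], by linarith [ht.2]⟩, ?_⟩
      rcases eq_or_lt_of_le ht.1 with h' | h'
      · subst h'
        simp [concatPath, h]
      · have : ¬ (t + 1) / 2 ≤ 1 / 2 := by linarith
        simp only [concatPath, if_neg this]
        congr 1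
        ring

lemma IsSimpleArc.concat {A B : Set Plane} {p q r : Plane} (hA : IsSimpleArc A p q)
    (hB : IsSimpleArc B q r) (hAB : ∀ z ∈ A, z ∈ B → z = q) : IsSimpleArc (A ∪ B) p r := by
  obtain ⟨f, hf, hfi, hf0, hf1, rfl⟩ := hA
  obtain ⟨g, hg, hgi, hg0, hg1, rfl⟩ := hB
  have h : f 1 = g 0 := hf1.trans hg0.symm
  have key : ∀ s t : ℝ, s ∈ Set.Icc (0 : ℝ) 1 → t ∈ Set.Icc (0 : ℝ) 1 → s ≤ 1 / 2 → ¬ t ≤ 1 / 2 →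
      f (2 * s) ≠ g (2 * t - 1) := by
    intro s t hs ht hs' ht' e
    have ht1 : 2 * t - 1 ∈ Set.Icc (0 : ℝ) 1 := ⟨by linarith, by linarith [ht.2]⟩
    have hz := hAB _ ⟨2 * s, ⟨by linarith [hs.1], by linarith⟩, rfl⟩ ⟨2 * t - 1, ht1, e.symm⟩
    have := hgi ht1 ⟨le_rfl, zero_le_one⟩ (by rw [← e, hz, hg0])
    linarith
  refine ⟨concatPath f g, continuousOn_concatPath hf hg h, ?_, ?_, ?_, image_concatPath h⟩
  · intro s hs t ht e
    by_cases hs' : s ≤ 1 / 2 <;> by_cases ht' : t ≤ 1 / 2 <;>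
      simp only [concatPath, hs', ht', if_true, if_false] at e
    · have := hfi ⟨by linarith [hs.1], by linarith⟩ ⟨by linarith [ht.1], by linarith⟩ e
      linarith
    · exact absurd e (key s t hs ht hs' ht')
    · exact absurd e.symm (key t s ht hs ht' hs')
    · have := hgi ⟨by linarith, by linarith [hs.2]⟩ ⟨by linarith, by linarith [ht.2]⟩ e
      linarith
  · simp [concatPath, hf0]
  · have : ¬ (1 : ℝ) ≤ 1 / 2 := by norm_num
    simp only [concatPath, if_neg this]
    norm_num [hg1]

lemma IsSimpleArc.isJordanCurve {A B : Set Plane} {p q : Plane} (hA : IsSimpleArc A p q)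
    (hB : IsSimpleArc B q p) (hAB : ∀ z ∈ A, z ∈ B → z = p ∨ z = q) : IsJordanCurve (A ∪ B) := by
  obtain ⟨f, hf, hfi, hf0, hf1, rfl⟩ := hA
  obtain ⟨g, hg, hgi, hg0, hg1, rfl⟩ := hB
  have h : f 1 = g 0 := hf1.trans hg0.symm
  have key : ∀ s t : ℝ, s ∈ Set.Ico (0 : ℝ) 1 → t ∈ Set.Ico (0 : ℝ) 1 → s ≤ 1 / 2 → ¬ t ≤ 1 / 2 →
      f (2 * s) ≠ g (2 * t - 1) := by
    intro s t hs ht hs' ht' e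
    have ht1 : 2 * t - 1 ∈ Set.Icc (0 : ℝ) 1 := ⟨by linarith, by linarith [ht.2]⟩
    rcases hAB _ ⟨2 * s, ⟨by linarith [hs.1], by linarith⟩, rfl⟩ ⟨2 * t - 1, ht1, e.symm⟩
      with hz | hz
    · have := hgi ht1 ⟨zero_le_one, le_rfl⟩ (by rw [← e, hz, hg1])
      linarith [ht.2]
    · have := hgi ht1 ⟨le_rfl, zero_le_one⟩ (by rw [← e, hz, hg0])
      linarith
  refine ⟨concatPath f g, continuousOn_concatPath hf hg h, ?_, ?_, image_concatPath h⟩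
  · have : ¬ (1 : ℝ) ≤ 1 / 2 := by norm_num
    simp only [concatPath, if_neg this]
    norm_num [hg1, hf0]
  · intro s hs t ht e
    by_cases hs' : s ≤ 1 / 2 <;> by_cases ht' : t ≤ 1 / 2 <;>
      simp only [concatPath, hs', ht', if_true, if_false] at e
    · have := hfi ⟨by linarith [hs.1], by linarith⟩ ⟨by linarith [ht.1], by linarith⟩ e
      linarith
    · exact absurd e (key s t hs ht hs' ht')
    · exact absurd e.symm (key t s ht hs ht' hs')
    · have := hgi ⟨by linarith, by linarith [hs.2]⟩ ⟨by linarith, by linarith [ht.2]⟩ e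
      linarith

/-! ### A circular arc in the coordinates of its chord. -/

lemma plane_ext {X Y : Plane} (h0 : X 0 = Y 0) (h1 : X 1 = Y 1) : X = Y := by
  ext i
  fin_cases i
  · exact h0
  · exact h1

/-- Equation of a circular arc in the coordinates `s` along and `g` across its chord, where
`r` stands for twice the distance of the centre from the chord. -/
def ArcEq (l r s g : ℝ) : Prop :=
  0 ≤ g ∧ s * (l - s) = g ^ 2 + r * g

/-- Twice the distance of the centre of a circular arc of height `η` and chord length `l` from
the chord. -/
noncomputable def centerOffset (l η : ℝ) : ℝ :=
  l ^ 2 / (4 * η) - η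

/-- In the orthonormal frame (u, v), (-v, u) at P, the equation of the circle loses its constant
term, because P lies on it. What remains is a polynomial relation without square roots. -/
lemma mem_circularArc_iff {P Q X : Plane} {l u v η : ℝ} (hl : 0 < l) (hη : 0 < η)
    (huv : u ^ 2 + v ^ 2 = 1) (h0 : Q 0 = P 0 + l * u) (h1 : Q 1 = P 1 + l * v) :
    X ∈ circularArc P Q η ↔ ArcEq l (centerOffset l η)
      ((X 0 - P 0) * u + (X 1 - P 1) * v) (-(X 0 - P 0) * v + (X 1 - P 1) * u) := by
  have hd : dist P Q = l := by
    rw [EuclideanSpace.dist_eq, Fin.sum_univ_two, Real.dist_eq, Real.dist_eq, sq_abs, sq_abs, h0,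
      h1, Real.sqrt_eq_iff_mul_self_eq (by positivity) hl.le]
    linear_combination l ^ 2 * huv
  have hn0 : leftNormal P Q 0 = -v := by
    simp only [leftNormal, hd, h1, PiLp.smul_apply, smul_eq_mul]
    simp
    field_simp
  have hn1 : leftNormal P Q 1 = u := by
    simp only [leftNormal, hd, h0, PiLp.smul_apply, smul_eq_mul]
    simp
    field_simp
  have hm0 : midpoint ℝ P Q 0 = P 0 + l * u / 2 := by
    simp [midpoint_eq_smul_add, h0]; ring
  have hm1 : midpoint ℝ P Q 1 = P 1 + l * v / 2 := by
    simp [midpoint_eq_smul_add, h1]; ring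
  have hR : 0 < arcRadius P Q η := by
    rw [arcRadius]; positivity
  have hinner : inner ℝ (X - midpoint ℝ P Q) (leftNormal P Q) =
      -(X 0 - P 0) * v + (X 1 - P 1) * u := by
    simp only [PiLp.inner_apply, Fin.sum_univ_two, PiLp.sub_apply, hn0, hn1, hm0, hm1]
    simp
    ring
  have hρ : η - arcRadius P Q η = -(centerOffset l η / 2) := by
    rw [arcRadius, hd, centerOffset]; field_simp; ring
  have hR2 : arcRadius P Q η ^ 2 = (l / 2) ^ 2 + (centerOffset l η / 2) ^ 2 := by
    rw [arcRadius, hd, centerOffset]; field_simp; ring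
  have hc0 : arcCenter P Q η 0 = P 0 + l * u / 2 + (centerOffset l η / 2) * v := by
    simp only [arcCenter, PiLp.add_apply, PiLp.smul_apply, smul_eq_mul, hm0, hn0, hρ]; ring
  have hc1 : arcCenter P Q η 1 = P 1 + l * v / 2 - (centerOffset l η / 2) * u := by
    simp only [arcCenter, PiLp.add_apply, PiLp.smul_apply, smul_eq_mul, hm1, hn1, hρ]; ring
  simp only [circularArc, Set.mem_ofPred_eq, hinner, ArcEq]
  rw [and_comm]
  refine and_congr_right fun _ => ?_
  rw [EuclideanSpace.dist_eq, Fin.sum_univ_two, Real.dist_eq, Real.dist_eq, sq_abs, sq_abs,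
    Real.sqrt_eq_iff_mul_self_eq (by positivity) hR.le, ← sq, hR2, hc0, hc1]
  set a := X 0 - P 0
  set b := X 1 - P 1
  set k := centerOffset l η
  have e0 : X 0 - (P 0 + l * u / 2 + k / 2 * v) = a - l * u / 2 - k / 2 * v := by ring
  have e1 : X 1 - (P 1 + l * v / 2 - k / 2 * u) = b - l * v / 2 + k / 2 * u := by ring
  rw [e0, e1]
  constructor <;> intro h
  · linear_combination (-1) * h + (-(a ^ 2 + b ^ 2) + (l / 2) ^ 2 + (k / 2) ^ 2) * huv
  · linear_combination (-1) * h + (-(a ^ 2 + b ^ 2) + (l / 2) ^ 2 + (k / 2) ^ 2) * huv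

/-- The arc is a graph over its chord: since r > 0, the quadratic relation has exactly one root g ≥
0 for each s in [0, l]. -/
lemma isSimpleArc_circularArc {P Q : Plane} {l u v η : ℝ} (hl : 0 < l) (hη : 0 < η)
    (huv : u ^ 2 + v ^ 2 = 1) (h0 : Q 0 = P 0 + l * u) (h1 : Q 1 = P 1 + l * v)
    (hr : 0 < centerOffset l η) : IsSimpleArc (circularArc P Q η) P Q := by
  set r := centerOffset l η
  let G : ℝ → ℝ := fun s => √(r ^ 2 / 4 + s * (l - s)) - r / 2
  let F : ℝ → Plane := fun t =>
    !₂[P 0 + t * l * u - G (t * l) * v, P 1 + t * l * v + G (t * l) * u]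
  have F0 : ∀ t, F t 0 = P 0 + t * l * u - G (t * l) * v := fun t => by simp [F]
  have F1 : ∀ t, F t 1 = P 1 + t * l * v + G (t * l) * u := fun t => by simp [F]
  have hs : ∀ t, (F t 0 - P 0) * u + (F t 1 - P 1) * v = t * l := fun t => by
    rw [F0, F1]; linear_combination t * l * huv
  have hg : ∀ t, -(F t 0 - P 0) * v + (F t 1 - P 1) * u = G (t * l) := fun t => by
    rw [F0, F1]; linear_combination G (t * l) * huv
  have hG : ∀ s g, 0 ≤ s * (l - s) → (ArcEq l r s g ↔ g = G s) := by
    intro s g hs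
    have hq : 0 ≤ r ^ 2 / 4 + s * (l - s) := by positivity
    constructor
    · rintro ⟨h, h'⟩
      have : √(r ^ 2 / 4 + s * (l - s)) = g + r / 2 := by
        rw [Real.sqrt_eq_iff_mul_self_eq hq (by positivity), h']; ring
      simp only [G, this]; ring
    · rintro rfl
      have e := Real.sq_sqrt hq
      refine ⟨?_, ?_⟩
      · have : r / 2 ≤ √(r ^ 2 / 4 + s * (l - s)) :=
          Real.le_sqrt_of_sq_le (by nlinarith)
        simp only [G]; linarith
      · simp only [G]; linear_combination -e
  have G0 : G 0 = 0 := ((hG 0 0 (by simp)).1 (by simp [ArcEq])).symm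
  have Gl : G l = 0 := ((hG l 0 (by simp)).1 (by simp [ArcEq])).symm
  refine ⟨F, ?_, ?_, ?_, ?_, ?_⟩
  · apply Continuous.continuousOn
    simp only [F, G]
    fun_prop
  · intro s _ t _ e
    have := hs s
    rw [e, hs t] at this
    exact mul_right_cancel₀ hl.ne' this.symm
  · exact plane_ext (by rw [F0]; simp [G0]) (by rw [F1]; simp [G0])
  · exact plane_ext (by rw [F0]; simp [Gl, h0]) (by rw [F1]; simp [Gl, h1])
  · ext X
    rw [mem_circularArc_iff hl hη huv h0 h1]
    constructor
    · rintro ⟨t, ht, rfl⟩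
      rw [hs, hg, hG _ _]
      have := ht.1
      have : 0 ≤ 1 - t := by linarith [ht.2]
      have e : t * l * (l - t * l) = l ^ 2 * (t * (1 - t)) := by ring
      rw [e]; positivity
    · intro hX
      set s := (X 0 - P 0) * u + (X 1 - P 1) * v with hsd
      set g := -(X 0 - P 0) * v + (X 1 - P 1) * u with hgd
      have hpos : 0 ≤ s * (l - s) := by
        rw [hX.2]; have := hX.1; positivity
      have hgG := (hG _ _ hpos).1 hX
      have hs0 : 0 ≤ s := by nlinarith
      have hs1 : s ≤ l := by nlinarith
      refine ⟨s / l, ⟨by positivity, (div_le_one hl).2 hs1⟩, ?_⟩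
      have e : s / l * l = s := by field_simp
      refine plane_ext ?_ ?_
      · rw [F0, e, ← hgG, hsd, hgd]; linear_combination (X 0 - P 0) * huv
      · rw [F1, e, ← hgG, hsd, hgd]; linear_combination (X 1 - P 1) * huv

/-! ### Closure and frontier of the interior of a closed set. -/

/-- The points off `γ` that can be joined to infinity by a straight ray missing `γ` do not lie in
the closure of the interior of `γ`. -/
lemma not_mem_closure_jordanInterior {γ : Set Plane} (hγ : IsClosed γ) {z d : Plane} (hd : d ≠ 0)
    (h : ∀ t : ℝ, 0 ≤ t → z + t • d ∉ γ) : z ∉ closure (jordanInterior γ) := by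
  have hz : z ∈ γᶜ := by simpa using h 0 le_rfl
  set C := connectedComponentIn γᶜ z
  have hC : IsOpen C := hγ.isOpen_compl.connectedComponentIn
  have hzC : z ∈ C := mem_connectedComponentIn hz
  have hub : ¬ Bornology.IsBounded C := by
    intro hb
    have hsub : (fun t : ℝ => z + t • d) '' Set.Ici 0 ⊆ C := by
      apply IsPreconnected.subset_connectedComponentIn
      · exact isPreconnected_Ici.image _ (by fun_prop)
      · exact ⟨0, by simp, by simp⟩
      · rintro _ ⟨t, ht, rfl⟩
        exact h t ht
    obtain ⟨M, hM⟩ := (hb.subset hsub).subset_closedBall z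
    have hdn : 0 < ‖d‖ := norm_pos_iff.2 hd
    have := hM ⟨(|M| + 1) / ‖d‖, by simp; positivity, rfl⟩
    rw [Metric.mem_closedBall, dist_eq_norm, add_sub_cancel_left, norm_smul, Real.norm_eq_abs,
      abs_of_nonneg (by positivity)] at this
    field_simp at this
    linarith [le_abs_self M]
  intro hcl
  obtain ⟨w, hwC, hw⟩ := mem_closure_iff.1 hcl C hC hzC
  apply hub
  have e : C = connectedComponentIn γᶜ w := connectedComponentIn_eq hwC
  rw [e]
  exact hw.2

/-- The components of the complement are open, so a point off γ that is a limit of interior points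
shares its component with one of them. -/
lemma frontier_jordanInterior_subset {γ : Set Plane} (hγ : IsClosed γ) :
    frontier (jordanInterior γ) ⊆ γ := by
  intro z hz
  by_contra hzγ
  set C := connectedComponentIn γᶜ z
  have hC : IsOpen C := hγ.isOpen_compl.connectedComponentIn
  have hzC : z ∈ C := mem_connectedComponentIn hzγ
  obtain ⟨w, hwC, hw⟩ := mem_closure_iff.1 hz.1 C hC hzC
  have e : C = connectedComponentIn γᶜ w := connectedComponentIn_eq hwC
  apply hz.2
  refine mem_interior.2 ⟨C, fun y hy => ⟨connectedComponentIn_subset _ _ hy, ?_⟩, hC, hzC⟩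
  rw [← connectedComponentIn_eq hy, show connectedComponentIn γᶜ z = C from rfl, e]
  exact hw.2

lemma triangle_subset_closure_interior {P Q R : Plane} (h : ¬ Collinear ℝ {P, Q, R}) :
    triangle P Q R ⊆ closure (interior (triangle P Q R)) := by
  have hai : AffineIndependent ℝ ![P, Q, R] := affineIndependent_iff_not_collinear_set.2 h
  have hspan : affineSpan ℝ (Set.range ![P, Q, R]) = ⊤ := by
    rw [hai.affineSpan_eq_top_iff_card_eq_finrank_add_one]
    simp
  have hne : (interior (triangle P Q R)).Nonempty := by
    rw [triangle, interior_convexHull_nonempty_iff_affineSpan_eq_top, ← hspan]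
    congr 1
    ext z
    simp [eq_comm]
    tauto
  have hcv : Convex ℝ (triangle P Q R) := convex_convexHull _ _
  rw [hcv.closure_interior_eq_closure_of_nonempty_interior hne]
  exact subset_closure

/-! ### The region between a chord and its arc. -/

/-- Only an inequality is assumed, so that the bounds also hold for midpoints of chords of the arc.
They confine the region to wedges of slope l / r at both ends. -/
lemma ArcEq.bounds {l r s g : ℝ} (hl : 0 < l) (hr : 0 < r) (hg : 0 ≤ g)
    (h : g ^ 2 + r * g ≤ s * (l - s)) :
    0 ≤ s ∧ s ≤ l ∧ r * g ≤ l * s ∧ r * g ≤ l * (l - s) := by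
  have h0 : 0 ≤ s * (l - s) := le_trans (by positivity) h
  have hs0 : 0 ≤ s := by nlinarith
  have hs1 : s ≤ l := by nlinarith
  exact ⟨hs0, hs1, by nlinarith, by nlinarith⟩

/-- Strict convexity of the disc, in the form of the parallelogram law. -/
lemma ArcEq.midpoint_lt {l r s s' g g' : ℝ} (h : ArcEq l r s g) (h' : ArcEq l r s' g')
    (hne : s ≠ s' ∨ g ≠ g') :
    0 ≤ (g + g') / 2 ∧ ((g + g') / 2) ^ 2 + r * ((g + g') / 2) <
      (s + s') / 2 * (l - (s + s') / 2) := by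
  refine ⟨by linarith [h.1, h'.1], ?_⟩
  have h1 := h.2
  have h2 := h'.2
  have hpos : 0 < (s - s') ^ 2 + (g - g') ^ 2 := by
    rcases hne with h | h
    · have := sub_ne_zero.2 h; positivity
    · have := sub_ne_zero.2 h; positivity
  nlinarith

/-! ### The bumped hourglass and its free points. -/

/-- The data of an hourglass with slightly bumped sides: `σ`, `c` are sine and cosine of the angle
at the outer vertices, `l` is the length of the slanted sides, `h` half the height, `L` half the
width, `r₁` and `r₂` the offsets of the centres of the arcs, `δ` a bound for the height of the
horizontal arcs, and `q` the cotangent of the angle to be excluded. -/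
structure HourglassData where
  (σ c l h L r₁ r₂ δ q : ℝ)
  σ_pos : 0 < σ
  l_pos : 0 < l
  h_pos : 0 < h
  sq_add_sq : c ^ 2 + σ ^ 2 = 1
  slope : 5 / 2 * σ < c
  l_mul_σ : l * σ = h
  l_mul_c : l * c = L - 1 / 2
  sq_h : h ^ 2 = 1 / 2
  r₁_pos : 0 < r₁
  r₂_pos : 0 < r₂
  -- The next four fields express flatness of the arcs: lower bounds on the offsets, hence true for
  -- small η.
  le_r₁ : 8 * L ≤ r₁ * σ
  sq_L_le : L ^ 2 ≤ δ * r₁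
  le_r₂ : 4 * l ≤ r₂ * σ
  le_r₂' : 4 * l ≤ r₂ * (c - 5 / 2 * σ)
  δ_le : δ ≤ 1 / 100
  q_lt : q + δ < h

namespace HourglassData

variable (H : HourglassData)

/-- The upper horizontal arc. -/
def Cap (x y : ℝ) : Prop := ArcEq (2 * H.L) H.r₁ (H.L - x) (H.h - y)

/-- The upper right slanted arc. -/
def Side (x y : ℝ) : Prop :=
  ArcEq H.l H.r₂ ((x - 1 / 2) * H.c + y * H.σ) (-(x - 1 / 2) * H.σ + y * H.c)

/-- The bumped hourglass in coordinates. -/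
def Curve (x y : ℝ) : Prop :=
  (H.Cap x y ∨ H.Cap x (-y)) ∨ (H.Side x y ∨ H.Side x (-y)) ∨ (H.Side (-x) y ∨ H.Side (-x) (-y))

/-- The point `(x, y)` can be joined to infinity by a ray missing the bumped hourglass. -/
def Free (x y : ℝ) : Prop :=
  ∃ d e : ℝ, (d ≠ 0 ∨ e ≠ 0) ∧ ∀ t, 0 ≤ t → ¬ H.Curve (x + t * d) (y + t * e)

variable {H}

lemma c_pos : 0 < H.c := by linarith [H.slope, H.σ_pos]

lemma c_le_one : H.c ≤ 1 := by nlinarith [H.sq_add_sq, sq_nonneg H.σ]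

lemma σ_le : H.σ ≤ 2 / 5 := by linarith [H.slope, c_le_one (H := H)]

lemma h_bounds : 7 / 10 < H.h ∧ H.h < 71 / 100 := by
  constructor <;> nlinarith [H.sq_h, H.h_pos]

lemma half_lt_L : 1 / 2 < H.L := by
  have := mul_pos H.l_pos (c_pos (H := H))
  linarith [H.l_mul_c]

lemma curve_neg_left {x y : ℝ} : H.Curve (-x) y ↔ H.Curve x y := by
  unfold Curve Cap ArcEq
  rw [neg_neg]
  have e : (H.L - -x) * (2 * H.L - (H.L - -x)) = (H.L - x) * (2 * H.L - (H.L - x)) := by ring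
  rw [e]
  tauto

lemma curve_neg_right {x y : ℝ} : H.Curve x (-y) ↔ H.Curve x y := by
  unfold Curve
  rw [neg_neg]
  tauto

lemma Free.neg_left {x y : ℝ} (h : H.Free x y) : H.Free (-x) y := by
  obtain ⟨d, e, hde, h⟩ := h
  refine ⟨-d, e, by simpa using hde, fun t ht => ?_⟩
  rw [show -x + t * -d = -(x + t * d) by ring, curve_neg_left]
  exact h t ht

lemma Free.neg_right {x y : ℝ} (h : H.Free x y) : H.Free x (-y) := by
  obtain ⟨d, e, hde, h⟩ := h
  refine ⟨d, -e, by simpa using hde, fun t ht => ?_⟩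
  rw [show -y + t * -e = -(y + t * e) by ring, curve_neg_right]
  exact h t ht

/-- The slope at the corners is at most σ / 4, half the slope σ / 2 below which `side_bounds` keeps
the slanted arc. This gap separates neighbouring arcs. -/
lemma cap_bounds {x y : ℝ} (hg : 0 ≤ H.h - y)
    (h : (H.h - y) ^ 2 + H.r₁ * (H.h - y) ≤ (H.L - x) * (2 * H.L - (H.L - x))) :
    -H.L ≤ x ∧ x ≤ H.L ∧ y ≤ H.h ∧ H.h - y ≤ H.δ ∧ H.h - y ≤ H.σ / 4 * (H.L - x) ∧
      H.h - y ≤ H.σ / 4 * (H.L + x) := by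
  have hL : 0 < H.L := by linarith [half_lt_L (H := H)]
  obtain ⟨h0, h1, h2, h3⟩ := ArcEq.bounds (by linarith) H.r₁_pos hg h
  have hr := H.r₁_pos
  refine ⟨by linarith, by linarith, by linarith, ?_, ?_, ?_⟩
  · refine le_of_mul_le_mul_left ?_ hr
    nlinarith [H.sq_L_le, sq_nonneg x, sq_nonneg (H.h - y)]
  · refine le_of_mul_le_mul_left ?_ hr
    nlinarith [mul_le_mul_of_nonneg_right H.le_r₁ h0]
  · refine le_of_mul_le_mul_left ?_ hr
    nlinarith [mul_le_mul_of_nonneg_right H.le_r₁ (by linarith : 0 ≤ H.L + x)]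

lemma Cap.bounds {x y : ℝ} (h : H.Cap x y) :
    -H.L ≤ x ∧ x ≤ H.L ∧ y ≤ H.h ∧ H.h - y ≤ H.δ ∧ H.h - y ≤ H.σ / 4 * (H.L - x) ∧
      H.h - y ≤ H.σ / 4 * (H.L + x) :=
  cap_bounds h.1 h.2.ge

/-- Flatness lets the bumped side keep two properties of the straight one: it stays within slope 2/5
at the waist, and below the cap's wedge at the corner. -/
lemma side_bounds {x y : ℝ} (hg : 0 ≤ -(x - 1 / 2) * H.σ + y * H.c)
    (h : (-(x - 1 / 2) * H.σ + y * H.c) ^ 2 + H.r₂ * (-(x - 1 / 2) * H.σ + y * H.c) ≤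
      ((x - 1 / 2) * H.c + y * H.σ) * (H.l - ((x - 1 / 2) * H.c + y * H.σ))) :
    0 ≤ y ∧ 5 / 2 * y ≤ x - 1 / 2 ∧ H.σ / 2 * (H.L - x) ≤ H.h - y ∧
      -(x - 1 / 2) * H.σ + y * H.c ≤ H.σ / 4 * ((x - 1 / 2) * H.c + y * H.σ) ∧
      -(x - 1 / 2) * H.σ + y * H.c ≤ H.σ / 4 * (H.l - ((x - 1 / 2) * H.c + y * H.σ)) := by
  obtain ⟨h0, h1, h2, h3⟩ := ArcEq.bounds H.l_pos H.r₂_pos hg h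
  have hσ := H.σ_pos
  have hc := c_pos (H := H)
  have hc1 := c_le_one (H := H)
  have hσ1 := σ_le (H := H)
  have hr := H.r₂_pos
  have ex : x - 1 / 2 = ((x - 1 / 2) * H.c + y * H.σ) * H.c -
      (-(x - 1 / 2) * H.σ + y * H.c) * H.σ := by
    linear_combination (-(x - 1 / 2)) * H.sq_add_sq
  have ey : y = ((x - 1 / 2) * H.c + y * H.σ) * H.σ + (-(x - 1 / 2) * H.σ + y * H.c) * H.c := by
    linear_combination (-y) * H.sq_add_sq
  have eh := H.l_mul_σ
  have eL := H.l_mul_c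
  generalize (x - 1 / 2) * H.c + y * H.σ = s at *
  generalize -(x - 1 / 2) * H.σ + y * H.c = g at *
  have b1 : g ≤ H.σ / 4 * s := by
    refine le_of_mul_le_mul_left ?_ hr
    nlinarith [mul_le_mul_of_nonneg_right H.le_r₂ h0]
  have b2 : g ≤ H.σ / 4 * (H.l - s) := by
    refine le_of_mul_le_mul_left ?_ hr
    nlinarith [mul_le_mul_of_nonneg_right H.le_r₂ (by linarith : 0 ≤ H.l - s)]
  have b3 : 4 * g ≤ (H.c - 5 / 2 * H.σ) * s := by
    refine le_of_mul_le_mul_left ?_ hr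
    nlinarith [mul_le_mul_of_nonneg_right H.le_r₂' h0]
  have hl : 0 ≤ H.l - s := by linarith
  refine ⟨?_, ?_, ?_, b1, b2⟩
  · rw [ey]; positivity
  · have : g * (H.σ + 5 / 2 * H.c) ≤ g * 4 := mul_le_mul_of_nonneg_left (by linarith) hg
    rw [ey, ex]
    nlinarith
  · have e1 : H.h - y = (H.l - s) * H.σ - g * H.c := by linear_combination (-1) * eh - ey
    have e2 : H.L - x = (H.l - s) * H.c + g * H.σ := by linear_combination (-1) * eL - ex
    rw [e1, e2]
    have t1 : g * (H.c + H.σ / 2 * H.σ) ≤ g * 2 :=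
      mul_le_mul_of_nonneg_left (by nlinarith) hg
    have t2 : H.σ / 2 * ((H.l - s) * H.c) ≤ H.σ / 2 * (H.l - s) :=
      mul_le_mul_of_nonneg_left (by nlinarith) (by linarith)
    nlinarith

lemma Side.bounds {x y : ℝ} (h : H.Side x y) :
    0 ≤ y ∧ 5 / 2 * y ≤ x - 1 / 2 ∧ H.σ / 2 * (H.L - x) ≤ H.h - y :=
  have := side_bounds h.1 h.2.ge
  ⟨this.1, this.2.1, this.2.2.1⟩

lemma Side.eq_half {x : ℝ} (h : H.Side x 0) : x = 1 / 2 := by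
  have h1 := h.1
  have h2 := h.bounds
  nlinarith [H.σ_pos]

lemma eq_corner_of_cap_of_side {x y : ℝ} (hc : H.Cap x y) (hs : H.Side x y) :
    x = H.L ∧ y = H.h := by
  obtain ⟨-, a1, a2, -, a3, -⟩ := hc.bounds
  obtain ⟨-, -, b⟩ := hs.bounds
  have hσ := H.σ_pos
  have e : x = H.L := by nlinarith
  subst e
  exact ⟨rfl, by linarith⟩

lemma free_axis {x : ℝ} (hx : 1 / 2 < x) : H.Free x 0 := by
  refine ⟨1, 0, by simp, fun t ht => ?_⟩
  have hh := h_bounds (H := H)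
  have hδ := H.δ_le
  rintro ((h | h) | (h | h) | (h | h))
  · have := h.bounds; linarith
  · have := h.bounds; linarith
  · rw [show (0 : ℝ) + t * 0 = 0 by ring] at h
    have := h.eq_half; linarith
  · rw [show -((0 : ℝ) + t * 0) = 0 by ring] at h
    have := h.eq_half; linarith
  · have := h.bounds; linarith
  · have := h.bounds; linarith

/-- The midpoint lies strictly on the outer side of the arc, and the vertical ray upwards leaves the
hourglass. -/
lemma free_midpoint_cap {x y x' y' : ℝ} (h : H.Cap x y) (h' : H.Cap x' y')
    (hne : x ≠ x' ∨ y ≠ y') : H.Free ((x + x') / 2) ((y + y') / 2) := by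
  obtain ⟨hg, hlt⟩ := ArcEq.midpoint_lt h h' (by
    rcases hne with h | h
    · left; contrapose! h; linarith
    · right; contrapose! h; linarith)
  rw [show (H.h - y + (H.h - y')) / 2 = H.h - (y + y') / 2 by ring] at hg hlt
  rw [show (H.L - x + (H.L - x')) / 2 = H.L - (x + x') / 2 by ring] at hlt
  generalize (x + x') / 2 = X at *
  generalize (y + y') / 2 = Y at *
  obtain ⟨a1, a2, a3, a4, a5, a6⟩ := cap_bounds hg hlt.le
  have hh := h_bounds (H := H)
  have hδ := H.δ_le
  have hσ := H.σ_pos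
  have hr := H.r₁_pos
  have hpos : 0 < (H.L - X) * (2 * H.L - (H.L - X)) := lt_of_le_of_lt (by positivity) hlt
  have hX1 : X < H.L := by
    rcases eq_or_lt_of_le a2 with e | e
    · rw [e] at hpos; simp at hpos
    · exact e
  have hX2 : -H.L < X := by
    rcases eq_or_lt_of_le a1 with e | e
    · rw [← e] at hpos; ring_nf at hpos; simp at hpos
    · exact e
  have p1 : 0 < H.σ * (H.L - X) := mul_pos hσ (by linarith)
  have p2 : 0 < H.σ * (H.L + X) := mul_pos hσ (by linarith)
  refine ⟨0, 1, by simp, fun t ht => ?_⟩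
  rw [show X + t * 0 = X by ring, show Y + t * 1 = Y + t by ring]
  rintro ((h | h) | (h | h) | (h | h))
  · have h1 := h.1
    have h2 := h.2
    nlinarith
  · have := h.bounds; linarith
  · have := h.bounds; linarith
  · have := h.bounds; linarith
  · have := h.bounds; linarith
  · have := h.bounds; linarith

/-- The horizontal ray to the right works. The point to check is that it does not meet the same arc
again. -/
lemma free_midpoint_side {x y x' y' : ℝ} (h : H.Side x y) (h' : H.Side x' y')
    (hne : x ≠ x' ∨ y ≠ y') : H.Free ((x + x') / 2) ((y + y') / 2) := by
  have hσ := H.σ_pos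
  have hc := c_pos (H := H)
  have hc1 := c_le_one (H := H)
  obtain ⟨hg, hlt⟩ := ArcEq.midpoint_lt h h' (by
    by_contra! hcon
    obtain ⟨e1, e2⟩ := hcon
    have ex : x = x' := by
      linear_combination H.c * e1 - H.σ * e2 - (x - x') * H.sq_add_sq
    have ey : y = y' := by
      linear_combination H.σ * e1 + H.c * e2 - (y - y') * H.sq_add_sq
    tauto)
  rw [show (-(x - 1 / 2) * H.σ + y * H.c + (-(x' - 1 / 2) * H.σ + y' * H.c)) / 2 =
    -((x + x') / 2 - 1 / 2) * H.σ + (y + y') / 2 * H.c by ring] at hg hlt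
  rw [show ((x - 1 / 2) * H.c + y * H.σ + ((x' - 1 / 2) * H.c + y' * H.σ)) / 2 =
    ((x + x') / 2 - 1 / 2) * H.c + (y + y') / 2 * H.σ by ring] at hlt
  generalize (x + x') / 2 = X at *
  generalize (y + y') / 2 = Y at *
  obtain ⟨a1, a2, a3, a4, a5⟩ := side_bounds hg hlt.le
  have hr := H.r₂_pos
  have hl := H.l_pos
  have ey : Y = ((X - 1 / 2) * H.c + Y * H.σ) * H.σ + (-(X - 1 / 2) * H.σ + Y * H.c) * H.c := by
    linear_combination (-Y) * H.sq_add_sq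
  have hray : ∀ t, 0 ≤ t → ¬ H.Side (X + t) Y := by
    rintro t ht ⟨h1, h2⟩
    rw [show -(X + t - 1 / 2) * H.σ + Y * H.c = (-(X - 1 / 2) * H.σ + Y * H.c) - t * H.σ by ring]
      at h1 h2
    rw [show (X + t - 1 / 2) * H.c + Y * H.σ = ((X - 1 / 2) * H.c + Y * H.σ) + t * H.c by ring]
      at h2
    generalize (X - 1 / 2) * H.c + Y * H.σ = s at *
    generalize -(X - 1 / 2) * H.σ + Y * H.c = g at *
    have hs0 : 0 ≤ s := by nlinarith
    have hs1 : s ≤ H.l := by nlinarith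
    -- A hit needs g ≥ tσ, while g ≤ σ(l - s)/4. For such t, s(l - s) - g² - r₂g changes along the
    -- ray by at least 3lt - t² ≥ 0, so it stays positive and the arc is not reached.
    have ht1 : 4 * t ≤ H.l := by
      refine le_of_mul_le_mul_left ?_ hσ
      nlinarith
    have hder : 3 * H.l ≤ H.c * H.l - 2 * H.c * s + 2 * H.σ * g + H.r₂ * H.σ := by
      have : H.c * s ≤ 1 * H.l := mul_le_mul hc1 hs1 hs0 zero_le_one
      have : H.c * (H.l - s) ≥ 0 := by apply mul_nonneg <;> linarith
      have : H.σ * g ≥ 0 := by positivity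
      linarith [H.le_r₂]
    have key : t ^ 2 = t ^ 2 * (H.c ^ 2 + H.σ ^ 2) := by rw [H.sq_add_sq, mul_one]
    nlinarith [mul_le_mul_of_nonneg_left hder ht]
  have hpos : 0 < ((X - 1 / 2) * H.c + Y * H.σ) * (H.l - ((X - 1 / 2) * H.c + Y * H.σ)) :=
    lt_of_le_of_lt (by positivity) hlt
  have hs := ArcEq.bounds hl hr hg hlt.le
  have hs0 : 0 < (X - 1 / 2) * H.c + Y * H.σ := by nlinarith
  have hs1 : (X - 1 / 2) * H.c + Y * H.σ < H.l := by nlinarith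
  have hY : 0 < Y := by rw [ey]; positivity
  have hYh : Y < H.h := by
    rw [ey, ← H.l_mul_σ]
    generalize (X - 1 / 2) * H.c + Y * H.σ = s at *
    generalize -(X - 1 / 2) * H.σ + Y * H.c = g at *
    have : g * H.c ≤ g * 1 := mul_le_mul_of_nonneg_left hc1 hg
    nlinarith [mul_pos hσ (by linarith : 0 < H.l - s)]
  have hh := h_bounds (H := H)
  have hδ := H.δ_le
  refine ⟨1, 0, by simp, fun t ht => ?_⟩
  rw [show X + t * 1 = X + t by ring, show Y + t * 0 = Y by ring]
  rintro ((h | h) | (h | h) | (h | h))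
  · have h1 := h.bounds
    have : H.σ * (H.L - (X + t)) ≤ 0 := by nlinarith
    have : 0 ≤ H.σ * (H.L - (X + t)) := mul_nonneg hσ.le (by linarith)
    linarith
  · have := h.bounds; linarith
  · exact hray t ht h
  · have := h.bounds; linarith
  · have := h.bounds; linarith
  · have := h.bounds; linarith

end HourglassData

/-! ### Triangles with small cotangents. -/

namespace HourglassData

variable {H : HourglassData}

/-- The dot product of the sides of a triangle at its vertex `p`. -/
def dotAt (p q r : ℝ × ℝ) : ℝ := (q.1 - p.1) * (r.1 - p.1) + (q.2 - p.2) * (r.2 - p.2)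

/-- Twice the oriented area of a triangle. -/
def crossAt (p q r : ℝ × ℝ) : ℝ := (q.1 - p.1) * (r.2 - p.2) - (q.2 - p.2) * (r.1 - p.1)

variable (H) in
/-- No point of the segment from `p` to `q` is free. -/
def Visible (p q : ℝ × ℝ) : Prop :=
  ∀ a b : ℝ, 0 ≤ a → 0 ≤ b → a + b = 1 → ¬ H.Free (a * p.1 + b * q.1) (a * p.2 + b * q.2)

lemma Visible.symm {p q : ℝ × ℝ} (h : H.Visible p q) : H.Visible q p := by
  intro a b ha hb hab
  rw [add_comm (a * q.1), add_comm (a * q.2)]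
  exact h b a hb ha (by linarith)

variable (H) in
/-- A triangle with vertices on the bumped hourglass and sides within it, the cotangents of whose
angles are all at most `q`. -/
structure FatTriangle (p q r : ℝ × ℝ) : Prop where
  curve₁ : H.Curve p.1 p.2
  curve₂ : H.Curve q.1 q.2
  curve₃ : H.Curve r.1 r.2
  vis₁ : H.Visible q r
  vis₂ : H.Visible p r
  vis₃ : H.Visible p q
  cross_ne : crossAt p q r ≠ 0
  dot₁ : dotAt p q r ≤ H.q * |crossAt p q r|
  dot₂ : dotAt q p r ≤ H.q * |crossAt p q r|
  dot₃ : dotAt r p q ≤ H.q * |crossAt p q r|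

/-- Reflection in the vertical axis. -/
def flipX (p : ℝ × ℝ) : ℝ × ℝ := (-p.1, p.2)

/-- Reflection in the horizontal axis. -/
def flipY (p : ℝ × ℝ) : ℝ × ℝ := (p.1, -p.2)

lemma Visible.flipX {p q : ℝ × ℝ} (h : H.Visible p q) : H.Visible (flipX p) (flipX q) := by
  intro a b ha hb hab hf
  apply h a b ha hb hab
  have := hf.neg_left
  simp only [HourglassData.flipX] at this
  convert this using 1
  ring

lemma Visible.flipY {p q : ℝ × ℝ} (h : H.Visible p q) : H.Visible (flipY p) (flipY q) := by
  intro a b ha hb hab hf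
  apply h a b ha hb hab
  have := hf.neg_right
  simp only [HourglassData.flipY] at this
  convert this using 1
  ring

lemma abs_crossAt_flipX (p q r : ℝ × ℝ) :
    |crossAt (flipX p) (flipX q) (flipX r)| = |crossAt p q r| := by
  rw [← abs_neg]
  congr 1
  simp only [crossAt, flipX]
  ring

lemma abs_crossAt_flipY (p q r : ℝ × ℝ) :
    |crossAt (flipY p) (flipY q) (flipY r)| = |crossAt p q r| := by
  rw [← abs_neg]
  congr 1
  simp only [crossAt, flipY]
  ring

lemma dotAt_flipX (p q r : ℝ × ℝ) : dotAt (flipX p) (flipX q) (flipX r) = dotAt p q r := by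
  simp only [dotAt, flipX]
  ring

lemma dotAt_flipY (p q r : ℝ × ℝ) : dotAt (flipY p) (flipY q) (flipY r) = dotAt p q r := by
  simp only [dotAt, flipY]
  ring

namespace FatTriangle

lemma flipX {p q r : ℝ × ℝ} (h : H.FatTriangle p q r) :
    H.FatTriangle (flipX p) (flipX q) (flipX r) where
  curve₁ := curve_neg_left.2 h.curve₁
  curve₂ := curve_neg_left.2 h.curve₂
  curve₃ := curve_neg_left.2 h.curve₃
  vis₁ := h.vis₁.flipX
  vis₂ := h.vis₂.flipX
  vis₃ := h.vis₃.flipX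
  cross_ne := by rw [← abs_pos, abs_crossAt_flipX, abs_pos]; exact h.cross_ne
  dot₁ := by rw [dotAt_flipX, abs_crossAt_flipX]; exact h.dot₁
  dot₂ := by rw [dotAt_flipX, abs_crossAt_flipX]; exact h.dot₂
  dot₃ := by rw [dotAt_flipX, abs_crossAt_flipX]; exact h.dot₃

lemma flipY {p q r : ℝ × ℝ} (h : H.FatTriangle p q r) :
    H.FatTriangle (flipY p) (flipY q) (flipY r) where
  curve₁ := curve_neg_right.2 h.curve₁
  curve₂ := curve_neg_right.2 h.curve₂
  curve₃ := curve_neg_right.2 h.curve₃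
  vis₁ := h.vis₁.flipY
  vis₂ := h.vis₂.flipY
  vis₃ := h.vis₃.flipY
  cross_ne := by rw [← abs_pos, abs_crossAt_flipY, abs_pos]; exact h.cross_ne
  dot₁ := by rw [dotAt_flipY, abs_crossAt_flipY]; exact h.dot₁
  dot₂ := by rw [dotAt_flipY, abs_crossAt_flipY]; exact h.dot₂
  dot₃ := by rw [dotAt_flipY, abs_crossAt_flipY]; exact h.dot₃

lemma swap₁₂ {p q r : ℝ × ℝ} (h : H.FatTriangle p q r) : H.FatTriangle q p r := by
  have e : |crossAt q p r| = |crossAt p q r| := by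
    rw [← abs_neg]; congr 1; simp only [crossAt]; ring
  refine ⟨h.curve₂, h.curve₁, h.curve₃, h.vis₂, h.vis₁, h.vis₃.symm, ?_, ?_, ?_, ?_⟩
  · rw [← abs_pos, e, abs_pos]; exact h.cross_ne
  · rw [e]; exact h.dot₂
  · rw [e]; exact h.dot₁
  · rw [e]; exact le_of_eq_of_le (by simp only [dotAt]; ring) h.dot₃

lemma swap₂₃ {p q r : ℝ × ℝ} (h : H.FatTriangle p q r) : H.FatTriangle p r q := by
  have e : |crossAt p r q| = |crossAt p q r| := by
    rw [← abs_neg]; congr 1; simp only [crossAt]; ring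
  refine ⟨h.curve₁, h.curve₃, h.curve₂, h.vis₁.symm, h.vis₃, h.vis₂, ?_, ?_, ?_, ?_⟩
  · rw [← abs_pos, e, abs_pos]; exact h.cross_ne
  · rw [e]; exact le_of_eq_of_le (by simp only [dotAt]; ring) h.dot₁
  · rw [e]; exact h.dot₃
  · rw [e]; exact h.dot₂

lemma ne {p q r : ℝ × ℝ} (h : H.FatTriangle p q r) : p ≠ q := by
  rintro rfl
  apply h.cross_ne
  simp [crossAt]

/-- The angles of a fat triangle are acute. -/
lemma dotAt_nonneg {p q r : ℝ × ℝ} (h : H.FatTriangle p q r) : 0 ≤ dotAt p q r := by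
  have hq : H.q < 1 := by
    have h1 := h_bounds (H := H)
    have h2 := H.q_lt
    have h3 : 0 ≤ H.δ := by
      have := H.sq_L_le
      have := H.r₁_pos
      by_contra! hneg
      nlinarith [sq_nonneg H.L]
    linarith
  have hS := abs_pos.2 h.cross_ne
  have h2 := h.dot₂
  have h3 := h.dot₃
  -- The identity cot A cot B + cot B cot C + cot C cot A = 1, cleared of denominators. A negative
  -- cot A would force cot B cot C ≥ 1, impossible as both are at most q < 1.
  have e : dotAt p q r * (dotAt q p r + dotAt r p q) + dotAt q p r * dotAt r p q =
      |crossAt p q r| ^ 2 := by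
    rw [sq_abs]; simp only [dotAt, crossAt]; ring
  have epos : 0 ≤ dotAt q p r + dotAt r p q := by
    have : dotAt q p r + dotAt r p q = (q.1 - r.1) ^ 2 + (q.2 - r.2) ^ 2 := by
      simp only [dotAt]; ring
    rw [this]; positivity
  by_contra! hneg
  generalize |crossAt p q r| = S at *
  have hle : S ^ 2 ≤ dotAt q p r * dotAt r p q := by nlinarith
  have h2' : dotAt q p r < S := by nlinarith
  have h3' : dotAt r p q < S := by nlinarith
  rcases le_or_gt 0 (dotAt q p r) with h0 | h0
  · nlinarith
  · nlinarith

end FatTriangle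

/-! ### Which zones of the curve can see each other. -/

variable (H) in
/-- The upper horizontal arc as a set of pairs. -/
def Top (p : ℝ × ℝ) : Prop := H.Cap p.1 p.2

variable (H) in
/-- The two slanted arcs on the right as a set of pairs. -/
def Right (p : ℝ × ℝ) : Prop := H.Side p.1 p.2 ∨ H.Side p.1 (-p.2)

lemma curve_cases {p : ℝ × ℝ} (h : H.Curve p.1 p.2) :
    (H.Top p ∨ H.Top (flipY p)) ∨ (H.Right p ∨ H.Right (flipX p)) := by
  rcases h with (h | h) | (h | h) | (h | h)
  · exact Or.inl (Or.inl h)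
  · exact Or.inl (Or.inr h)
  · exact Or.inr (Or.inl (Or.inl h))
  · exact Or.inr (Or.inl (Or.inr h))
  · exact Or.inr (Or.inr (Or.inl h))
  · exact Or.inr (Or.inr (Or.inr h))

lemma flipY_flipY (p : ℝ × ℝ) : flipY (flipY p) = p := by simp [flipY]

lemma Right.flipY {p : ℝ × ℝ} (h : H.Right p) : H.Right (flipY p) := by
  rcases h with h | h
  · right; simpa [HourglassData.flipY] using h
  · left; exact h

lemma Top.flipX {p : ℝ × ℝ} (h : H.Top p) : H.Top (flipX p) := by
  refine ⟨h.1, ?_⟩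
  have := h.2
  simp only [HourglassData.flipX]
  linear_combination this

lemma Right.bounds {p : ℝ × ℝ} (h : H.Right p) : 5 / 2 * |p.2| ≤ p.1 - 1 / 2 := by
  rcases h with h | h
  · have := h.bounds
    rw [abs_of_nonneg this.1]
    exact this.2.1
  · have := h.bounds
    rw [abs_of_nonpos (by linarith)]
    exact this.2.1

/-- A visible segment crosses the horizontal axis within the waist. -/
lemma Visible.crossing {p q : ℝ × ℝ} (h : H.Visible p q) (hp : 0 ≤ p.2) (hq : q.2 < 0) :
    p.1 * (-q.2) + q.1 * p.2 ≤ 1 / 2 * (p.2 - q.2) ∧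
      -(1 / 2 * (p.2 - q.2)) ≤ p.1 * (-q.2) + q.1 * p.2 := by
  have hpos : 0 < p.2 - q.2 := by linarith
  have hn := h (-q.2 / (p.2 - q.2)) (p.2 / (p.2 - q.2)) (by apply div_nonneg <;> linarith)
    (by positivity) (by field_simp; ring)
  have ex : -q.2 / (p.2 - q.2) * p.1 + p.2 / (p.2 - q.2) * q.1 =
      (p.1 * (-q.2) + q.1 * p.2) / (p.2 - q.2) := by ring
  have ey : -q.2 / (p.2 - q.2) * p.2 + p.2 / (p.2 - q.2) * q.2 = 0 := by ring
  rw [ex, ey] at hn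
  constructor
  · by_contra! hlt
    exact hn (free_axis ((lt_div_iff₀ hpos).2 hlt))
  · by_contra! hlt
    apply hn
    rw [← neg_neg ((p.1 * (-q.2) + q.1 * p.2) / (p.2 - q.2))]
    refine (free_axis ?_).neg_left
    rw [← neg_div, lt_div_iff₀ hpos]
    linarith

lemma Visible.not_free_midpoint {p q : ℝ × ℝ} (h : H.Visible p q) :
    ¬ H.Free ((p.1 + q.1) / 2) ((p.2 + q.2) / 2) := by
  have := h (1 / 2) (1 / 2) (by norm_num) (by norm_num) (by norm_num)
  convert this using 2 <;> ring

lemma Visible.eq_of_top {p q : ℝ × ℝ} (h : H.Visible p q) (hp : H.Top p) (hq : H.Top q) :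
    p = q := by
  by_contra hne
  refine h.not_free_midpoint (free_midpoint_cap hp hq ?_)
  by_contra! hcon
  exact hne (Prod.ext hcon.1 hcon.2)

/-- On a common arc the midpoint is free. On different arcs of the notch, the slope bound puts the
crossing with the axis beyond the waist, unless one point is the waist vertex, which belongs to both
arcs. -/
lemma Visible.eq_of_right {p q : ℝ × ℝ} (h : H.Visible p q) (hp : H.Right p) (hq : H.Right q) :
    p = q := by
  have upper : ∀ {p q : ℝ × ℝ}, H.Visible p q → H.Side p.1 p.2 → H.Side q.1 q.2 → p = q := by
    intro p q h hp hq
    by_contra hne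
    refine h.not_free_midpoint (free_midpoint_side hp hq ?_)
    by_contra! hcon
    exact hne (Prod.ext hcon.1 hcon.2)
  have lower : ∀ {p q : ℝ × ℝ}, H.Visible p q → H.Side p.1 (-p.2) → H.Side q.1 (-q.2) → p = q := by
    intro p q h hp hq
    rw [← flipY_flipY p, upper h.flipY hp hq, flipY_flipY]
  have mixed : ∀ {p q : ℝ × ℝ}, H.Visible p q → H.Side p.1 p.2 → H.Side q.1 (-q.2) → p = q := by
    intro p q h hp hq
    have b := hp.bounds
    have b' := hq.bounds
    rcases eq_or_lt_of_le b.1 with e | h1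
    · refine lower h ?_ hq
      rw [← e] at hp ⊢
      rwa [neg_zero]
    rcases eq_or_lt_of_le b'.1 with e | h2
    · refine upper h hp ?_
      rw [← e] at hq
      rwa [show q.2 = 0 by linarith]
    have c := (h.crossing b.1 (by linarith)).1
    have c1 := mul_le_mul_of_nonneg_right b.2.1 h2.le
    have c2 := mul_le_mul_of_nonneg_right b'.2.1 h1.le
    have c3 := mul_pos h1 h2
    nlinarith
  rcases hp with hp | hp <;> rcases hq with hq | hq
  · exact upper h hp hq
  · exact mixed h hp hq
  · exact (mixed h.symm hq hp).symm
  · exact lower h hp hq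

/-! ### Excluding each distribution of the vertices. -/

namespace FatTriangle

/-- Two vectors in the octant between the directions 0° and 45° enclose at most 45°, so the cross
product is at most the dot product. -/
lemma abs_sub_mul_le {u₁ u₂ v₁ v₂ : ℝ} (hu : 0 ≤ u₂) (hu' : u₂ ≤ u₁) (hv : 0 ≤ v₂)
    (hv' : v₂ ≤ v₁) : |u₂ * v₁ - u₁ * v₂| ≤ u₁ * v₁ + u₂ * v₂ := by
  have p1 := mul_nonneg hu hv
  have p2 := mul_nonneg (sub_nonneg.2 hu') (hv.trans hv')
  have p3 := mul_nonneg (hu.trans hu') (sub_nonneg.2 hv')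
  have p4 := mul_nonneg hu (hv.trans hv')
  have p5 := mul_nonneg (hu.trans hu') hv
  apply abs_le.2
  constructor <;> linarith

/-- Moving b and c into the notches by a total height Y raises the height bound to h + Y, but widens
the base to at least 1 + 5Y/2. This exceeds 2h(h + Y) = 1 + 2hY unless Y = 0, so the base cotangents
still cannot both be below h. -/
lemma not_top_right_left {a b c : ℝ × ℝ} (h : H.FatTriangle a b c) (ha : H.Top a)
    (hb : H.Right b) (hc : H.Right (HourglassData.flipX c)) : False := by
  have hB := hb.bounds
  have hC := hc.bounds
  have hA := ha.bounds
  have hδ := H.δ_le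
  have hh := h_bounds (H := H)
  simp only [HourglassData.flipX] at hC
  have hS := abs_pos.2 h.cross_ne
  have d2 := h.dot₂
  have d3 := h.dot₃
  have n2 := h.swap₁₂.dotAt_nonneg
  have n3 := h.swap₂₃.swap₁₂.dotAt_nonneg
  have hq : H.q < H.h := by
    have h3 : 0 ≤ H.δ := by linarith [hA.2.2.1, hA.2.2.2.1]
    linarith [H.q_lt]
  set Y := |b.2| + |c.2| with hY
  have hY0 : 0 ≤ Y := by positivity
  have hw : 1 + 5 / 2 * Y ≤ b.1 - c.1 := by linarith
  -- The vertical component of the altitude from a, times |bc|² = D + E. Its foot is (E b + D c) /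
  -- (D + E), a convex combination because the base angles are acute.
  have e : |crossAt a b c| * (b.1 - c.1) = |a.2 * (dotAt b a c + dotAt c a b) -
      (dotAt c a b * b.2 + dotAt b a c * c.2)| := by
    have hw0 : |b.1 - c.1| = b.1 - c.1 := abs_of_nonneg (by linarith)
    rw [← hw0, ← abs_mul, ← abs_neg]
    congr 1
    simp only [dotAt, crossAt]
    ring
  generalize |crossAt a b c| = S at *
  generalize dotAt b a c = D at *
  generalize dotAt c a b = E at *
  have e1 : |a.2 * (D + E) - (E * b.2 + D * c.2)| ≤ H.h * (D + E) + (E + D) * Y := by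
    have a1 : |a.2| ≤ H.h := abs_le.2 ⟨by linarith, hA.2.2.1⟩
    calc |a.2 * (D + E) - (E * b.2 + D * c.2)|
        ≤ |a.2 * (D + E)| + (|E * b.2| + |D * c.2|) :=
          (abs_sub _ _).trans (add_le_add_right (abs_add_le _ _) _)
      _ = |a.2| * (D + E) + (E * |b.2| + D * |c.2|) := by
          rw [abs_mul, abs_mul, abs_mul, abs_of_nonneg n2, abs_of_nonneg n3,
            abs_of_nonneg (add_nonneg n2 n3)]
      _ ≤ H.h * (D + E) + (E + D) * Y := by
          have := mul_le_mul_of_nonneg_right a1 (add_nonneg n2 n3)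
          have := mul_nonneg n3 (abs_nonneg c.2)
          have := mul_nonneg n2 (abs_nonneg b.2)
          rw [hY]
          linarith
  rw [← e] at e1
  have e2 : (D + E) * (H.h + Y) ≤ 2 * H.q * S * (H.h + Y) :=
    mul_le_mul_of_nonneg_right (by linarith) (by linarith)
  have e3 : H.q * (S * (H.h + Y)) < H.h * (S * (H.h + Y)) :=
    mul_lt_mul_of_pos_right hq (by have := H.h_pos; positivity)
  have e4 : S * (1 + 5 / 2 * Y) ≤ S * (b.1 - c.1) := mul_le_mul_of_nonneg_left hw hS.le
  have e5 : S * (2 * H.h * Y) ≤ S * (5 / 2 * Y) :=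
    mul_le_mul_of_nonneg_left (mul_le_mul_of_nonneg_right (by linarith) hY0) hS.le
  have e6 : S * (2 * H.h ^ 2) = S := by rw [H.sq_h]; ring
  nlinarith

lemma not_top_bot_right_of_nonneg {a b c : ℝ × ℝ} (h : H.FatTriangle a c b) (ha : H.Top a)
    (hc : H.Top (HourglassData.flipY c)) (hb : H.Right b) (hb0 : 0 ≤ b.2) : False := by
  have hA := ha.bounds
  have hC := hc.bounds
  have hB := hb.bounds
  simp only [HourglassData.flipY] at hC
  have hδ := H.δ_le
  have hh := h_bounds (H := H)
  have hS := abs_pos.2 h.cross_ne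
  have hq := H.q_lt
  have hδ0 : 0 ≤ H.δ := by linarith [hA.2.2.1, hA.2.2.2.1]
  have x1 := h.vis₃.crossing (by linarith) (by linarith)
  have x0 := h.vis₁.symm.crossing hb0 (by linarith)
  rcases eq_or_lt_of_le hb0 with e | hpos
  · have hb1 : b.1 = 1 / 2 := by
      rcases hb with hb | hb
      · rw [← e] at hb; exact hb.eq_half
      · rw [← e, neg_zero] at hb; exact hb.eq_half
    -- Twice the area is the vertical extent of ac times the distance along the axis from b to ac,
    -- and that distance is at most the waist width 1.
    have hle : |crossAt a c b| ≤ a.2 - c.2 := by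
      simp only [crossAt]
      rw [hb1, ← e]
      apply abs_le.2
      constructor <;> nlinarith
    have hsum : (a.2 - c.2) ^ 2 ≤ dotAt a c b + dotAt c a b := by
      simp only [dotAt]
      nlinarith [sq_nonneg (a.1 - c.1)]
    have h1 := h.dot₁
    have h2 := h.dot₂
    have h3 : 2 * (H.h - H.δ) ≤ a.2 - c.2 := by linarith
    have h4 : 0 < a.2 - c.2 := by linarith
    generalize |crossAt a c b| = S at *
    generalize a.2 - c.2 = w at *
    have h5 : w ^ 2 ≤ 2 * H.q * S := by linarith
    have hq0 : 0 < H.q := by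
      by_contra! hneg
      nlinarith
    nlinarith
  · rw [abs_of_pos hpos] at hB
    have hm : 69 / 100 ≤ -c.2 := by linarith
    -- The segment bc passes the axis at or left of 1/2, while b lies beyond the slope bound; so c
    -- is far to the left, and the angle at c turns out to be at most 45°.
    have hcx : c.1 ≤ 1 / 2 + 5 / 2 * c.2 := by
      refine le_of_mul_le_mul_left ?_ hpos
      nlinarith
    have hv1 : b.2 - c.2 ≤ b.1 - c.1 := by linarith
    have hu1 : a.2 - c.2 ≤ a.1 - c.1 := by
      refine le_of_mul_le_mul_left ?_ (by linarith : 0 < -c.2)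
      have hs : 0 ≤ a.2 - c.2 := by linarith
      have h1 := mul_le_mul_of_nonneg_left hcx hs
      have h2 : 0 ≤ (a.2 - c.2) * (-c.2 - 2 / 3) := mul_nonneg hs (by linarith)
      linarith [x1.2]
    have hu2 : 0 < a.2 - c.2 := by linarith
    have hv2 : 0 < b.2 - c.2 := by linarith
    have hle : |crossAt a c b| ≤ dotAt c a b := by
      have : crossAt a c b = (a.2 - c.2) * (b.1 - c.1) - (a.1 - c.1) * (b.2 - c.2) := by
        simp only [crossAt]; ring
      rw [this, dotAt]
      exact abs_sub_mul_le hu2.le hu1 hv2.le hv1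
    have h2 := h.dot₂
    have h3 : H.q * |crossAt a c b| < |crossAt a c b| := mul_lt_of_lt_one_left hS (by linarith)
    linarith

lemma not_top_bot_right {a b c : ℝ × ℝ} (h : H.FatTriangle a c b) (ha : H.Top a)
    (hc : H.Top (HourglassData.flipY c)) (hb : H.Right b) : False := by
  rcases le_or_gt 0 b.2 with h0 | h0
  · exact h.not_top_bot_right_of_nonneg ha hc hb h0
  · refine h.flipY.swap₁₂.not_top_bot_right_of_nonneg hc ?_ hb.flipY ?_
    · rwa [flipY_flipY]
    · simp only [HourglassData.flipY]; linarith

lemma not_top_top {p q r : ℝ × ℝ} (h : H.FatTriangle p q r) (hp : H.Top p) (hq : H.Top q) :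
    False :=
  h.ne (h.vis₃.eq_of_top hp hq)

lemma not_right_right {p q r : ℝ × ℝ} (h : H.FatTriangle p q r) (hp : H.Right p)
    (hq : H.Right q) : False :=
  h.ne (h.vis₃.eq_of_right hp hq)

lemma not_top_bot {p q r : ℝ × ℝ} (h : H.FatTriangle p q r) (hp : H.Top p)
    (hq : H.Top (HourglassData.flipY q)) : False := by
  rcases curve_cases h.curve₃ with (hr | hr) | (hr | hr)
  · exact h.swap₂₃.not_top_top hp hr
  · exact h.flipY.swap₁₂.swap₂₃.not_top_top hq hr
  · exact h.not_top_bot_right hp hq hr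
  · exact h.flipX.not_top_bot_right hp.flipX hq.flipX hr

lemma not_top_right {p q r : ℝ × ℝ} (h : H.FatTriangle p q r) (hp : H.Top p)
    (hq : H.Right q) : False := by
  rcases curve_cases h.curve₃ with (hr | hr) | (hr | hr)
  · exact h.swap₂₃.not_top_top hp hr
  · exact h.swap₂₃.not_top_bot hp hr
  · exact h.swap₁₂.swap₂₃.not_right_right hq hr
  · exact h.not_top_right_left hp hq hr

lemma not_top {p q r : ℝ × ℝ} (h : H.FatTriangle p q r) (hp : H.Top p) : False := by
  rcases curve_cases h.curve₂ with (hq | hq) | (hq | hq)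
  · exact h.not_top_top hp hq
  · exact h.not_top_bot hp hq
  · exact h.not_top_right hp hq
  · exact h.flipX.not_top_right hp.flipX hq

lemma right_or_left {p q r : ℝ × ℝ} (h : H.FatTriangle p q r) :
    H.Right p ∨ H.Right (HourglassData.flipX p) := by
  rcases curve_cases h.curve₁ with (hp | hp) | hp
  · exact (h.not_top hp).elim
  · exact (h.flipY.not_top hp).elim
  · exact hp

end FatTriangle

/-- Horizontal arcs being excluded, three vertices share two notches, so two lie in the same one. -/
lemma not_fatTriangle (p q r : ℝ × ℝ) : ¬ H.FatTriangle p q r := by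
  intro h
  have h13 : H.FatTriangle p r q := h.swap₂₃
  have h23 : H.FatTriangle q r p := h.swap₁₂.swap₂₃
  rcases h.right_or_left with hp | hp <;> rcases h23.right_or_left with hq | hq <;>
    rcases h13.swap₁₂.right_or_left with hr | hr
  · exact h.not_right_right hp hq
  · exact h.not_right_right hp hq
  · exact h13.not_right_right hp hr
  · exact h23.flipX.not_right_right hq hr
  · exact h23.not_right_right hq hr
  · exact h13.flipX.not_right_right hp hr
  · exact h.flipX.not_right_right hp hq
  · exact h.flipX.not_right_right hp hq

end HourglassData

/-! ### From angles of plane triangles to cotangents. -/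

open HourglassData

/-- If the angle between `x` and `y` is at least `φ`, its cotangent is at most `cot φ`. -/
lemma inner_mul_sin_le {x y : Plane} {φ : ℝ} (hφ : 0 ≤ φ)
    (h : φ ≤ InnerProductGeometry.angle x y) :
    (x 0 * y 0 + x 1 * y 1) * Real.sin φ ≤ |x 0 * y 1 - x 1 * y 0| * Real.cos φ := by
  set a := InnerProductGeometry.angle x y
  have hin : ∀ x y : Plane, inner ℝ x y = x 0 * y 0 + x 1 * y 1 := by
    intro x y
    simp [PiLp.inner_apply, Fin.sum_univ_two]
    ring
  have hc := InnerProductGeometry.cos_angle_mul_norm_mul_norm x y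
  have hs := InnerProductGeometry.sin_angle_mul_norm_mul_norm x y
  rw [hin] at hc
  rw [hin, hin, hin, show (x 0 * x 0 + x 1 * x 1) * (y 0 * y 0 + y 1 * y 1) -
    (x 0 * y 0 + x 1 * y 1) * (x 0 * y 0 + x 1 * y 1) = (x 0 * y 1 - x 1 * y 0) ^ 2 by ring,
    Real.sqrt_sq_eq_abs] at hs
  rw [← hc, ← hs]
  have hsin : 0 ≤ Real.sin (a - φ) := by
    apply Real.sin_nonneg_of_nonneg_of_le_pi
    · linarith
    · linarith [InnerProductGeometry.angle_le_pi x y]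
  rw [Real.sin_sub] at hsin
  have hn : 0 ≤ ‖x‖ * ‖y‖ := by positivity
  nlinarith [mul_nonneg hn hsin]

/-- The coordinates of a point of the plane. -/
def coords (X : Plane) : ℝ × ℝ := (X 0, X 1)

lemma dotAt_le_of_angle {P Q R : Plane} {φ q : ℝ} (hφ : 0 ≤ φ) (hs : 0 < Real.sin φ)
    (hq : q * Real.sin φ = Real.cos φ) (h : φ ≤ EuclideanGeometry.angle Q P R) :
    dotAt (coords P) (coords Q) (coords R) ≤
      q * |crossAt (coords P) (coords Q) (coords R)| := by
  have := inner_mul_sin_le hφ h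
  rw [← hq] at this
  simp only [vsub_eq_sub, PiLp.sub_apply] at this
  refine le_of_mul_le_mul_right ?_ hs
  simp only [dotAt, crossAt, coords]
  linarith

/-- The two dot products add up to |pq|², which could not be positive if the area vanished. -/
lemma crossAt_ne_zero {p q r : ℝ × ℝ} {k : ℝ} (hpq : p ≠ q)
    (h₁ : dotAt p q r ≤ k * |crossAt p q r|) (h₂ : dotAt q p r ≤ k * |crossAt p q r|) :
    crossAt p q r ≠ 0 := by
  intro h0
  rw [h0, abs_zero, mul_zero] at h₁ h₂
  have e : dotAt p q r + dotAt q p r = (p.1 - q.1) ^ 2 + (p.2 - q.2) ^ 2 := by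
    simp only [dotAt]; ring
  apply hpq
  refine Prod.ext ?_ ?_ <;> nlinarith [sq_nonneg (p.1 - q.1), sq_nonneg (p.2 - q.2)]

/-- If the coordinates describe the closed curve `γ`, no triangle weakly inscribed in its interior
has all its angles at least `φ`. -/
lemma minAngle_lt_of_isWeaklyInscribed {H : HourglassData} {γ : Set Plane} (hγ : IsClosed γ)
    (hmem : ∀ X : Plane, X ∈ γ ↔ H.Curve (X 0) (X 1)) {φ : ℝ} (hφ : 0 < φ)
    (hs : 0 < Real.sin φ) (hq : H.q * Real.sin φ = Real.cos φ) {P Q R : Plane}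
    (h : IsWeaklyInscribed P Q R (jordanInterior γ)) : minAngle P Q R < φ := by
  by_contra! hlt
  obtain ⟨hint, hP, hQ, hR⟩ := h
  have hcol : ¬ Collinear ℝ {P, Q, R} := by
    intro hcol
    rw [minAngle, if_pos hcol] at hlt
    linarith
  rw [minAngle, if_neg hcol, le_min_iff, le_min_iff] at hlt
  obtain ⟨a1, a2, a3⟩ := hlt
  -- Only the open triangle is known to lie inside; taking closures brings in its sides, on which
  -- visibility is needed.
  have hT : triangle P Q R ⊆ closure (jordanInterior γ) :=
    (triangle_subset_closure_interior hcol).trans (closure_mono hint)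
  have hvis : ∀ X ∈ ({P, Q, R} : Set Plane), ∀ Y ∈ ({P, Q, R} : Set Plane),
      H.Visible (coords X) (coords Y) := by
    rintro X hX Y hY a b ha hb hab ⟨d, e, hde, hray⟩
    have hz : a • X + b • Y ∈ triangle P Q R :=
      (convex_convexHull ℝ _) (subset_convexHull ℝ _ hX) (subset_convexHull ℝ _ hY) ha hb hab
    refine not_mem_closure_jordanInterior hγ (d := !₂[d, e]) ?_ ?_ (hT hz)
    · intro h0
      have h0' : ∀ i, (!₂[d, e] : Plane) i = 0 := fun i => by rw [h0]; rfl
      have := h0' 0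
      have := h0' 1
      simp_all
    · intro t ht hmem'
      rw [hmem] at hmem'
      exact hray t ht (by simpa [coords] using hmem')
  have d1 := dotAt_le_of_angle hφ.le hs hq a1
  have d2 := dotAt_le_of_angle hφ.le hs hq a2
  have d3 := dotAt_le_of_angle hφ.le hs hq a3
  have e2 : |crossAt (coords Q) (coords P) (coords R)| =
      |crossAt (coords P) (coords Q) (coords R)| := by
    rw [← abs_neg]; congr 1; simp only [crossAt]; ring
  have e3 : |crossAt (coords R) (coords P) (coords Q)| =
      |crossAt (coords P) (coords Q) (coords R)| := by
    congr 1; simp only [crossAt]; ring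
  rw [e2] at d2
  rw [e3] at d3
  have hPQ : coords P ≠ coords Q := by
    intro e
    have : P = Q := plane_ext (congrArg Prod.fst e) (congrArg Prod.snd e)
    apply hcol
    rw [this, Set.insert_eq_of_mem (by simp)]
    exact collinear_pair ℝ Q R
  have hf := frontier_jordanInterior_subset hγ
  exact not_fatTriangle (coords P) (coords Q) (coords R)
    { curve₁ := (hmem P).1 (hf hP)
      curve₂ := (hmem Q).1 (hf hQ)
      curve₃ := (hmem R).1 (hf hR)
      vis₁ := hvis Q (by simp) R (by simp)
      vis₂ := hvis P (by simp) R (by simp)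
      vis₃ := hvis P (by simp) Q (by simp)
      cross_ne := crossAt_ne_zero hPQ d1 d2
      dot₁ := d1
      dot₂ := d2
      dot₃ := d3 }

/-! ### The six arcs in coordinates, and the Jordan curve they form. -/

section Arcs

variable {H : HourglassData} {P Q : Plane} {η : ℝ}

lemma mem_horizontal_arc_iff (hη : 0 < η) (hr : centerOffset (2 * H.L) η = H.r₁) {k : ℝ}
    (hk : k = 1 ∨ k = -1) (hP0 : P 0 = k * H.L) (hP1 : P 1 = k * H.h) (hQ0 : Q 0 = -(k * H.L))
    (hQ1 : Q 1 = k * H.h) :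
    IsSimpleArc (circularArc P Q η) P Q ∧
      ∀ X : Plane, X ∈ circularArc P Q η ↔ H.Cap (X 0) (k * X 1) := by
  have hl : 0 < 2 * H.L := by linarith [half_lt_L (H := H)]
  have huv : (-k) ^ 2 + (0 : ℝ) ^ 2 = 1 := by rcases hk with rfl | rfl <;> norm_num
  have h0 : Q 0 = P 0 + 2 * H.L * (-k) := by rw [hP0, hQ0]; ring
  have h1 : Q 1 = P 1 + 2 * H.L * 0 := by rw [hP1, hQ1]; ring
  refine ⟨isSimpleArc_circularArc hl hη huv h0 h1 (hr ▸ H.r₁_pos), fun X => ?_⟩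
  rw [mem_circularArc_iff hl hη huv h0 h1, hr, hP0, hP1]
  unfold Cap ArcEq
  rcases hk with rfl | rfl
  · ring_nf
  · refine and_congr ?_ ?_ <;> ring_nf

lemma mem_slanted_arc_iff (hη : 0 < η) (hr : centerOffset H.l η = H.r₂) {k : ℝ}
    (hk : k = 1 ∨ k = -1) (hP0 : P 0 = k * (1 / 2)) (hP1 : P 1 = 0) (hQ0 : Q 0 = k * H.L)
    (hQ1 : Q 1 = k * H.h) :
    IsSimpleArc (circularArc P Q η) P Q ∧
      ∀ X : Plane, X ∈ circularArc P Q η ↔ H.Side (k * X 0) (k * X 1) := by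
  have huv : (k * H.c) ^ 2 + (k * H.σ) ^ 2 = 1 := by
    rw [mul_pow, mul_pow, ← mul_add, H.sq_add_sq]
    rcases hk with rfl | rfl <;> norm_num
  have h0 : Q 0 = P 0 + H.l * (k * H.c) := by
    rw [hP0, hQ0]; linear_combination (-k) * H.l_mul_c
  have h1 : Q 1 = P 1 + H.l * (k * H.σ) := by
    rw [hP1, hQ1]; linear_combination (-k) * H.l_mul_σ
  refine ⟨isSimpleArc_circularArc H.l_pos hη huv h0 h1 (hr ▸ H.r₂_pos), fun X => ?_⟩
  rw [mem_circularArc_iff H.l_pos hη huv h0 h1, hr, hP0, hP1]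
  unfold Side
  rcases hk with rfl | rfl
  · ring_nf
  · ring_nf

/-- These arcs run towards the waist while `Side` measures from it, so s becomes l - s, under which
`ArcEq` is symmetric. -/
lemma mem_slanted_arc_iff' (hη : 0 < η) (hr : centerOffset H.l η = H.r₂) {k : ℝ}
    (hk : k = 1 ∨ k = -1) (hP0 : P 0 = k * H.L) (hP1 : P 1 = -(k * H.h)) (hQ0 : Q 0 = k * (1 / 2))
    (hQ1 : Q 1 = 0) :
    IsSimpleArc (circularArc P Q η) P Q ∧
      ∀ X : Plane, X ∈ circularArc P Q η ↔ H.Side (k * X 0) (-(k * X 1)) := by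
  have huv : (-(k * H.c)) ^ 2 + (k * H.σ) ^ 2 = 1 := by
    rw [neg_sq, mul_pow, mul_pow, ← mul_add, H.sq_add_sq]
    rcases hk with rfl | rfl <;> norm_num
  have h0 : Q 0 = P 0 + H.l * (-(k * H.c)) := by
    rw [hP0, hQ0]; linear_combination k * H.l_mul_c
  have h1 : Q 1 = P 1 + H.l * (k * H.σ) := by
    rw [hP1, hQ1]; linear_combination (-k) * H.l_mul_σ
  refine ⟨isSimpleArc_circularArc H.l_pos hη huv h0 h1 (hr ▸ H.r₂_pos), fun X => ?_⟩
  rw [mem_circularArc_iff H.l_pos hη huv h0 h1, hr, hP0, hP1]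
  unfold Side ArcEq
  have eL : H.L = H.l * H.c + 1 / 2 := by linarith [H.l_mul_c]
  have ek : k * k = 1 := by rcases hk with rfl | rfl <;> norm_num
  have eg : -(X 0 - k * H.L) * (k * H.σ) + (X 1 - -(k * H.h)) * -(k * H.c) =
      -(k * X 0 - 1 / 2) * H.σ + -(k * X 1) * H.c := by
    rw [eL, ← H.l_mul_σ]; linear_combination H.σ / 2 * ek
  have es : (X 0 - k * H.L) * -(k * H.c) + (X 1 - -(k * H.h)) * (k * H.σ) =
      H.l - ((k * X 0 - 1 / 2) * H.c + -(k * X 1) * H.σ) := by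
    rw [eL, ← H.l_mul_σ]; linear_combination (H.l * H.c ^ 2 + H.c / 2 + H.l * H.σ ^ 2) * ek +
      H.l * H.sq_add_sq
  rw [eg, es, sub_sub_cancel, mul_comm (H.l - _)]

end Arcs

lemma isClosed_circularArc (P Q : Plane) (η : ℝ) : IsClosed (circularArc P Q η) := by
  have h : Continuous fun X : Plane => inner ℝ (X - midpoint ℝ P Q) (leftNormal P Q) := by
    fun_prop
  have h' : Continuous fun X : Plane => dist X (arcCenter P Q η) := by fun_prop
  exact (isClosed_eq h' continuous_const).inter (isClosed_le continuous_const h)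

lemma isClosed_bumpedHourglass (α η : ℝ) : IsClosed (bumpedHourglass α η) :=
  isClosed_iUnion_of_finite fun _ => isClosed_circularArc _ _ _

lemma iUnion_fin_six (A : Fin 6 → Set Plane) :
    ⋃ i, A i = ((A 0 ∪ (A 1 ∪ A 2)) ∪ (A 3 ∪ (A 4 ∪ A 5))) := by
  ext z
  simp only [Set.mem_iUnion, Fin.exists_fin_succ, Set.mem_union]
  simp
  tauto

/-- Two chains of three arcs join the lower left to the upper right corner; the wedge bounds show
that distinct arcs meet only at common vertices. -/
lemma bumpedHourglass_spec {H : HourglassData} {α η : ℝ} (hη : 0 < η)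
    (hL : hourglassHalfWidth α = H.L) (hh : 1 / √2 = H.h)
    (hr₁ : centerOffset (2 * H.L) η = H.r₁) (hr₂ : centerOffset H.l η = H.r₂) :
    IsJordanCurve (bumpedHourglass α η) ∧
      ∀ X : Plane, X ∈ bumpedHourglass α η ↔ H.Curve (X 0) (X 1) := by
  set V := hourglassVertex α
  have V0 : V 0 = !₂[-H.L, -H.h] := by simp [V, hourglassVertex, hL, ← hh]
  have V1 : V 1 = !₂[H.L, -H.h] := by simp [V, hourglassVertex, hL, ← hh]
  have V2 : V 2 = !₂[1 / 2, 0] := by simp [V, hourglassVertex]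
  have V3 : V 3 = !₂[H.L, H.h] := by simp [V, hourglassVertex, hL, ← hh]
  have V4 : V 4 = !₂[-H.L, H.h] := by simp [V, hourglassVertex, hL, ← hh]
  have V5 : V 5 = !₂[-(1 / 2), 0] := by simp [V, hourglassVertex]
  obtain ⟨j0, m0⟩ := mem_horizontal_arc_iff (P := V 0) (Q := V 1) hη hr₁ (Or.inr rfl)
    (by simp [V0]) (by simp [V0]) (by simp [V1]) (by simp [V1])
  obtain ⟨j1, m1⟩ := mem_slanted_arc_iff' (P := V 1) (Q := V 2) hη hr₂ (Or.inl rfl)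
    (by simp [V1]) (by simp [V1]) (by simp [V2]) (by simp [V2])
  obtain ⟨j2, m2⟩ := mem_slanted_arc_iff (P := V 2) (Q := V 3) hη hr₂ (Or.inl rfl)
    (by simp [V2]) (by simp [V2]) (by simp [V3]) (by simp [V3])
  obtain ⟨j3, m3⟩ := mem_horizontal_arc_iff (P := V 3) (Q := V 4) hη hr₁ (Or.inl rfl)
    (by simp [V3]) (by simp [V3]) (by simp [V4]) (by simp [V4])
  obtain ⟨j4, m4⟩ := mem_slanted_arc_iff' (P := V 4) (Q := V 5) hη hr₂ (Or.inr rfl)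
    (by simp [V4]) (by simp [V4]) (by simp [V5]) (by simp [V5])
  obtain ⟨j5, m5⟩ := mem_slanted_arc_iff (P := V 5) (Q := V 0) hη hr₂ (Or.inr rfl)
    (by simp [V5]) (by simp [V5]) (by simp [V0]) (by simp [V0])
  simp only [one_mul, neg_mul, neg_neg] at m0 m1 m2 m3 m4 m5
  have hb : bumpedHourglass α η = (circularArc (V 0) (V 1) η ∪ (circularArc (V 1) (V 2) η ∪
      circularArc (V 2) (V 3) η)) ∪ (circularArc (V 3) (V 4) η ∪ (circularArc (V 4) (V 5) η ∪
      circularArc (V 5) (V 0) η)) :=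
    iUnion_fin_six fun i => circularArc (V i) (V (i + 1)) η
  have hh' := h_bounds (H := H)
  have hδ := H.δ_le
  have right : IsSimpleArc (circularArc (V 1) (V 2) η ∪ circularArc (V 2) (V 3) η) (V 1) (V 3) := by
    refine j1.concat j2 fun z hz hz' => ?_
    rw [m1] at hz
    rw [m2] at hz'
    have e : z 1 = 0 := by linarith [hz.bounds, hz'.bounds]
    rw [e] at hz'
    exact plane_ext (by simp [V2, hz'.eq_half]) (by simp [V2, e])
  have left : IsSimpleArc (circularArc (V 4) (V 5) η ∪ circularArc (V 5) (V 0) η) (V 4) (V 0) := by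
    refine j4.concat j5 fun z hz hz' => ?_
    rw [m4] at hz
    rw [m5] at hz'
    have e : z 1 = 0 := by linarith [hz.bounds, hz'.bounds]
    rw [e] at hz
    have := hz.eq_half
    exact plane_ext (by simp [V5]; linarith) (by simp [V5, e])
  have low := j0.concat right fun z hz hz' => by
    rw [Set.mem_union, m1, m2] at hz'
    rw [m0] at hz
    rcases hz' with hz' | hz'
    · have := eq_corner_of_cap_of_side hz hz'
      exact plane_ext (by simp [V1, this.1]) (by simp [V1, ← this.2])
    · linarith [hz.bounds, hz'.bounds]
  have high := j3.concat left fun z hz hz' => by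
    rw [Set.mem_union, m4, m5] at hz'
    rw [m3] at hz
    rcases hz' with hz' | hz'
    · have : -z 0 = H.L ∧ z 1 = H.h :=
        eq_corner_of_cap_of_side (Top.flipX (p := (z 0, z 1)) hz) hz'
      exact plane_ext (by simp [V4, ← this.1]) (by simp [V4, ← this.2])
    · linarith [hz.bounds, hz'.bounds]
  refine ⟨?_, fun X => ?_⟩
  · rw [hb]
    refine low.isJordanCurve high fun z hz hz' => ?_
    rw [Set.mem_union, Set.mem_union, m0, m1, m2] at hz
    rw [Set.mem_union, Set.mem_union, m3, m4, m5] at hz'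
    rcases hz with hz | hz | hz <;> rcases hz' with hz' | hz' | hz'
    · linarith [hz.bounds, hz'.bounds]
    · linarith [hz.bounds, hz'.bounds]
    · have : -z 0 = H.L ∧ -z 1 = H.h :=
        eq_corner_of_cap_of_side (Top.flipX (p := (z 0, -z 1)) hz) hz'
      exact Or.inl (plane_ext (by simp [V0, ← this.1]) (by simp [V0, ← this.2]))
    · linarith [hz.bounds, hz'.bounds]
    · linarith [hz.bounds, hz'.bounds]
    · linarith [hz.bounds, hz'.bounds]
    · have := eq_corner_of_cap_of_side hz' hz
      exact Or.inr (plane_ext (by simp [V3, this.1]) (by simp [V3, this.2]))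
    · linarith [hz.bounds, hz'.bounds]
    · linarith [hz.bounds, hz'.bounds]
  · rw [hb]
    simp only [Set.mem_union, m0, m1, m2, m3, m4, m5, Curve]
    tauto

/-! ### Numerical estimates and the choice of η. -/

open Filter Topology in
lemma tendsto_centerOffset {l : ℝ} (hl : 0 < l) :
    Tendsto (centerOffset l) (𝓝[>] 0) atTop := by
  have h1 : Tendsto (fun η : ℝ => l ^ 2 / 4 * η⁻¹) (𝓝[>] 0) atTop :=
    tendsto_inv_nhdsGT_zero.const_mul_atTop (by positivity)
  have h2 : Tendsto (fun η : ℝ => -η) (𝓝[>] 0) (𝓝 0) := by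
    have : Tendsto (fun η : ℝ => -η) (𝓝 0) (𝓝 (-0)) := tendsto_id.neg
    rw [neg_zero] at this
    exact this.mono_left nhdsWithin_le_nhds
  refine (h1.atTop_add h2).congr fun η => ?_
  rw [centerOffset]
  ring

/-- Numerical properties of the sine and the cosine of the angle `α` of the hourglass. -/
lemma hourglass_angle {α : ℝ} (hα : 0 < α) (hα' : α ≤ Real.arcsin (√2 / 4)) :
    0 < Real.sin α ∧ 5 / 2 * Real.sin α < Real.cos α := by
  have h2 : √2 ^ 2 = 2 := Real.sq_sqrt (by norm_num)
  have h2' : 0 ≤ √2 := Real.sqrt_nonneg 2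
  have hle : α ≤ Real.pi / 2 := hα'.trans (Real.arcsin_le_pi_div_two _)
  have hs : 0 < Real.sin α := Real.sin_pos_of_pos_of_lt_pi hα (by linarith [Real.pi_pos])
  have hs' : Real.sin α ≤ √2 / 4 :=
    (Real.le_arcsin_iff_sin_le ⟨by linarith [Real.pi_pos], hle⟩ ⟨by linarith, by nlinarith⟩).1 hα'
  have hc : 0 ≤ Real.cos α := Real.cos_nonneg_of_mem_Icc ⟨by linarith, hle⟩
  have hsc := Real.sin_sq_add_cos_sq α
  -- Hence cot² α ≥ 7 > (5/2)², the source of the constant 5/2.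
  have hsq : Real.sin α ^ 2 ≤ 1 / 8 := by nlinarith
  refine ⟨hs, ?_⟩
  have : (5 / 2 * Real.sin α) ^ 2 < Real.cos α ^ 2 := by nlinarith
  exact lt_of_pow_lt_pow_left₀ 2 hc this

/-- The cotangent decreases and equals 1/√2 at arctan √2. The bound ε ≤ 1 keeps the angle below π.
-/
lemma cot_arctan_sqrt_two_add {ε : ℝ} (hε : 0 < ε) (hε' : ε ≤ 1) :
    0 < Real.arctan √2 + ε ∧ 0 < Real.sin (Real.arctan √2 + ε) ∧
      Real.cos (Real.arctan √2 + ε) / Real.sin (Real.arctan √2 + ε) < 1 / √2 := by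
  have h2 : 0 < √2 := by positivity
  set θ := Real.arctan √2 with hθ
  have h0 : 0 < θ := Real.arctan_pos.2 h2
  have h1 : θ < Real.pi / 2 := Real.arctan_lt_pi_div_two _
  have hpi := Real.pi_gt_three
  have hs : 0 < Real.sin (θ + ε) :=
    Real.sin_pos_of_pos_of_lt_pi (by linarith) (by linarith)
  refine ⟨by linarith, hs, ?_⟩
  rw [div_lt_div_iff₀ hs h2, one_mul]
  have hc : 0 < Real.cos θ := Real.cos_arctan_pos _
  have ht : Real.sin θ = √2 * Real.cos θ := by
    have : Real.tan θ = √2 := Real.tan_arctan _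
    rw [Real.tan_eq_sin_div_cos, div_eq_iff hc.ne'] at this
    exact this
  have hse : 0 < Real.sin ε := Real.sin_pos_of_pos_of_lt_pi hε (by linarith)
  have e : Real.sin ε = Real.sin (θ + ε) * Real.cos θ - Real.cos (θ + ε) * Real.sin θ := by
    rw [← Real.sin_sub]; congr 1; ring
  rw [e, ht] at hse
  refine lt_of_mul_lt_mul_right ?_ hc.le
  linarith

open Filter Topology in
theorem corollary3p4 (α : ℝ) (hα : 0 < α) (hα' : α ≤ Real.arcsin (Real.sqrt 2 / 4))
    (ε : ℝ) (hε : 0 < ε) :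
    ∃ η : ℝ, 0 < η ∧ η < ε ∧ IsJordanCurve (bumpedHourglass α η) ∧
      ∀ P Q R : Plane, IsWeaklyInscribed P Q R (jordanInterior (bumpedHourglass α η)) →
        minAngle P Q R ≤ Real.arctan (Real.sqrt 2) + ε := by
  obtain ⟨hσ, hslope⟩ := hourglass_angle hα hα'
  obtain ⟨hφ, hsin, hcot⟩ := cot_arctan_sqrt_two_add (lt_min hε one_pos) (min_le_right ε 1)
  set φ := Real.arctan √2 + min ε 1 with hφd
  set q := Real.cos φ / Real.sin φ with hq
  set σ := Real.sin α with hσd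
  set c := Real.cos α with hcd
  set h := 1 / √2 with hhd
  set L := hourglassHalfWidth α with hL
  -- Half the gap between q and h leaves room for q + δ < h.
  set δ := min (1 / 100) ((h - q) / 2) with hδ
  have hh : 0 < h := by positivity
  have hc : 0 < c := by linarith
  have hl : 0 < h / σ := by positivity
  have hLc : h / σ * c = L - 1 / 2 := by
    rw [hL, hourglassHalfWidth, Real.tan_eq_sin_div_cos, ← hσd, ← hcd, hhd]
    field_simp
    ring
  have hL0 : 0 < L := by have := mul_pos hl hc; linarith
  have hδ0 : 0 < δ := lt_min (by norm_num) (by linarith)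
  have t1 := tendsto_centerOffset (show 0 < 2 * L by linarith)
  have t2 := tendsto_centerOffset hl
  have hsl : 0 < c - 5 / 2 * σ := by linarith
  obtain ⟨η, ⟨⟨⟨⟨⟨⟨⟨b1, b2⟩, b3⟩, b4⟩, b5⟩, b6⟩, b7⟩, b8⟩⟩ :=
    (((((((t1.eventually_gt_atTop 0).and (t1.eventually_ge_atTop (8 * L / σ))).and
      (t1.eventually_ge_atTop (L ^ 2 / δ))).and (t2.eventually_gt_atTop 0)).and
      (t2.eventually_ge_atTop (4 * (h / σ) / σ))).and
      (t2.eventually_ge_atTop (4 * (h / σ) / (c - 5 / 2 * σ)))).and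
      (self_mem_nhdsWithin)).and (Ioo_mem_nhdsGT hε) |>.exists
  let H : HourglassData :=
    { σ := σ, c := c, l := h / σ, h := h, L := L, r₁ := centerOffset (2 * L) η,
      r₂ := centerOffset (h / σ) η, δ := δ, q := q
      σ_pos := hσ
      l_pos := hl
      h_pos := hh
      sq_add_sq := Real.cos_sq_add_sin_sq α
      slope := hslope
      l_mul_σ := by field_simp
      l_mul_c := hLc
      sq_h := by rw [hhd, div_pow, Real.sq_sqrt (by norm_num)]; norm_num
      r₁_pos := b1
      r₂_pos := b4
      le_r₁ := (div_le_iff₀ hσ).1 b2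
      sq_L_le := by rw [mul_comm]; exact (div_le_iff₀ hδ0).1 b3
      le_r₂ := (div_le_iff₀ hσ).1 b5
      le_r₂' := (div_le_iff₀ hsl).1 b6
      δ_le := min_le_left _ _
      q_lt := by have : δ ≤ (h - q) / 2 := min_le_right _ _; linarith }
  obtain ⟨hJ, hmem⟩ := bumpedHourglass_spec (H := H) (α := α) (η := η) b8.1 rfl rfl rfl rfl
  refine ⟨η, b8.1, b8.2, hJ, fun P Q R hPQR => ?_⟩
  have := minAngle_lt_of_isWeaklyInscribed (isClosed_bumpedHourglass α η) hmem hφ hsin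
    (div_mul_cancel₀ _ hsin.ne') hPQR
  have : min ε 1 ≤ ε := min_le_left _ _
  linarith
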